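/- **Snake Lemma in a $\dagger$-effectus.** *Conventions.* An effectus (in partial form) is a category with finite coproducts, enriched over partial commutative monoids (PCMs), that satisfies the compatible sum and untying axioms and has an object $1$ such that each $\mathrm{Pred}\,X=\mathrm{Hom}(X,1)$ is an effect algebra (with top element also written $1$), $1\circ f\perp 1\circ g$ implies $f\perp g$, and $1\circ f=0$ implies $f=0$. - A quotient for $p\in\mathrm{Pred}\,X$ is a map universal among the maps $f$ out of $X$ with $1\circ f\le p^\perp$. A comprehension for $p$ is a map $\pi_p$ universal among the maps $g$ into $X$ with $p\circ g=1\circ g$. A map is pure if it is a comprehension after a quotient. - $\mathrm{im}\,f$ is the least predicate $p$ with $p\circ f=1\circ f$. Predicates of this form are sharp. $\mathrm{SPred}\,X$ is the poset of sharp predicates on $X$. A sharp quotient is a quotient for a sharp predicate. $\lceil p\rceil=(\mathrm{im}\,\pi_{p^\perp})^\perp$. - A $\diamond$-effectus is an effectus with all quotients, comprehensions and images in which $s^\perp$ is sharp whenever $s$ is. In it one writes $f^\diamond(s)=\lceil s\circ f\rceil$, $f_\diamond(s)=\mathrm{im}(f\circ\pi_s)$ and $f^\square(s)=f^\diamond(s^\perp)^\perp$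 for sharp $s$; maps $f,g$ are $\diamond$-adjoint if $f^\diamond=g_\diamond$. A pure endomap is $\diamond$-positive if it is $g\circ g$ for some $g$ that is $\diamond$-adjoint to itself. - An $\&$-effectus is a $\diamond$-effectus in which each predicate $p$ admits a unique $\diamond$-positive map $\mathrm{asrt}_p$ with $1\circ\mathrm{asrt}_p=p$, and $\xi\circ\pi$ is pure for each quotient $\xi$ and comprehension $\pi$. - A $\dagger$-effectus is an $\&$-effectus whose category of pure maps is a $\dagger$-category with $\mathrm{asrt}_p^\dagger=\mathrm{asrt}_p$, with each pure $f$ $\diamond$-adjoint to $f^\dagger$, with a unique $\dagger$-positive square root for each $\dagger$-positive map, and with all $\diamond$-positive maps $\dagger$-positive (that is, of the form $g^\dagger\circ g$ with $g$ pure). A $\dagger$-effectus has a zero object and all kernels and cokernels. $A\xrightarrow{f}B\xrightarrow{g}C$ is *exact at $B$* if $\ker(\mathrm{cok}\,f)$ and $\ker g$ are equal as subobjects of $B$. Let $\mathrm{Nsb}\,A$ be the poset of subobjects of $A$ that are kernels, with least element $0$ and greatest element $1$. For $f\colon A\to B$ put $f_*(m)=\ker(\mathrm{cok}(f\circ m))$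 and $f^*(n)=\ker(\mathrm{cok}(n)\circ f)$. Say that $f$ is *left-modular at* $m\in\mathrm{Nsb}\,A$ if $f^*(f_*(m))=m\vee f^*(0)$, and *right-modular at* $n\in\mathrm{Nsb}\,B$ if $f_*(f^*(n))=n\wedge f_*(1)$. For a sharp predicate $s$, modular at $s$ means modular at $\pi_s$. *Statement.* Let $$\begin{array}{ccccccc} & & A & \xrightarrow{f} & B & \xrightarrow{g} & C\xrightarrow{0}0\\ & & {\scriptstyle a}\downarrow & & {\scriptstyle b}\downarrow & & {\scriptstyle c}\downarrow\phantom{\xrightarrow{0}0}\\ 0 & \xrightarrow{0} & A' & \xrightarrow{h} & B' & \xrightarrow{k} & C'\phantom{\xrightarrow{0}0}\end{array}$$ be a commuting diagram in a $\dagger$-effectus. Consider the hypotheses (H) the rows are exact (at $B$, $C$, $A'$ and $B'$), $g$ is a cokernel of some map and $h$ is a kernel of some map; $b$ is left-modular at $\mathrm{im}\,f$; $b$ is right-modular at $\mathrm{im}\,h$; $f$ is right-modular at $\lceil 1\circ b\rceil^\perp$; $k$ is left-modular at $\mathrm{im}\,b$. 1. (H) holds if and only if all of the following hold, with joins and meets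 taken among sharp predicates: $b^\square b_\diamond(\mathrm{im} f)=\lceil 1\circ b\rceil^\perp\vee\mathrm{im} f$; $b_\diamond b^\square(\mathrm{im}\,h)=\mathrm{im}\,h\wedge\mathrm{im}\,b$; $k^\square k_\diamond(\mathrm{im}\,b)=\mathrm{im}\,h\vee\mathrm{im}\,b$; $f_\diamond f^\square b^\square(0)=\lceil 1\circ b\rceil^\perp\wedge\mathrm{im} f$; $(\mathrm{im} f)^\perp=\lceil 1\circ g\rceil$; $(\mathrm{im}\,h)^\perp=\lceil 1\circ k\rceil$; $g$ is a sharp quotient; $h$ is a comprehension. 2. Write $a_\pi,b_\pi,c_\pi$ for the kernels and $a_\zeta,b_\zeta,c_\zeta$ for the cokernels of $a,b,c$, and $\overline f\colon\ker a\to\ker b$, $\overline g\colon\ker b\to\ker c$, $\overline h\colon\mathrm{cok}\,a\to\mathrm{cok}\,b$, $\overline k\colon\mathrm{cok}\,b\to\mathrm{cok}\,c$ for the induced maps. Then $b_\pi,c_\pi,a_\zeta,b_\zeta$ are pure and $\overline f=b_\pi^\dagger\circ f\circ a_\pi$, $\overline g=c_\pi^\dagger\circ g\circ b_\pi$, $\overline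 h=b_\zeta\circ h\circ a_\zeta^\dagger$, $\overline k=c_\zeta\circ k\circ b_\zeta^\dagger$. 3. If (H) holds, there is a map $d\colon\ker c\to\mathrm{cok}\,a$ such that $$\ker a\xrightarrow{\overline f}\ker b\xrightarrow{\overline g}\ker c\xrightarrow{d}\mathrm{cok}\,a\xrightarrow{\overline h}\mathrm{cok}\,b\xrightarrow{\overline k}\mathrm{cok}\,c$$ is a long exact sequence, i.e. exact at $\ker b$, $\ker c$, $\mathrm{cok}\,a$ and $\mathrm{cok}\,b$. -/

import Mathlib

open CategoryTheory CategoryTheory.Limits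

universe v u w

namespace EffectusTheory

/-! ### Partial commutative monoids and effect algebras -/

/-- A partial commutative monoid: `oplus a b = some c` means that the sum of `a` and `b`
is defined and equals `c`; `oplus a b = none` means that it is undefined. -/
class PCM (M : Type w) [Zero M] where
  oplus : M → M → Option M
  oplus_comm : ∀ a b, oplus a b = oplus b a
  oplus_assoc : ∀ {a b c d e}, oplus a b = some d → oplus d c = some e →
    ∃ x, oplus b c = some x ∧ oplus a x = some e
  zero_oplus : ∀ a, oplus 0 a = some a

section PCM

variable {M : Type w} [Zero M] [PCM M]

/-- `a ⊥ b`: the sum of `a` and `b` is defined. -/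
def Perp (a b : M) : Prop := ∃ c, PCM.oplus a b = some c

/-- The algebraic (pre)order of a PCM. -/
def PLe (a b : M) : Prop := ∃ c, PCM.oplus a c = some b

/-- The PCM `M` is an effect algebra with unit `one`. -/
structure IsEffectAlgebra (one : M) : Prop where
  existsUnique_orth : ∀ a : M, ∃! b : M, PCM.oplus a b = some one
  zero_one : ∀ a : M, Perp a one → a = 0

theorem oplus_comm' {a b c : M} (h : PCM.oplus a b = some c) : PCM.oplus b a = some c := by
  rw [PCM.oplus_comm]; exact h

theorem oplus_zero (a : M) : PCM.oplus a 0 = some a := oplus_comm' (PCM.zero_oplus a)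

theorem PLe.refl (a : M) : PLe a a := ⟨0, oplus_zero a⟩

theorem PLe.trans {a b c : M} : PLe a b → PLe b c → PLe a c := by
  rintro ⟨x, hx⟩ ⟨y, hy⟩
  obtain ⟨z, _, hz⟩ := PCM.oplus_assoc hx hy
  exact ⟨z, hz⟩

theorem zero_ple (a : M) : PLe 0 a := ⟨a, PCM.zero_oplus a⟩

namespace IsEffectAlgebra

variable {one : M}

theorem cancel {a b b' c : M} (H : IsEffectAlgebra one)
    (h : PCM.oplus a b = some c) (h' : PCM.oplus a b' = some c) : b = b' := by
  obtain ⟨c', hc, _⟩ := H.existsUnique_orth c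
  obtain ⟨x, hx, hbx⟩ := PCM.oplus_assoc (oplus_comm' h) hc
  obtain ⟨y, hy, hby⟩ := PCM.oplus_assoc (oplus_comm' h') hc
  obtain rfl : x = y := by
    rw [hx] at hy
    exact Option.some.inj hy
  exact (H.existsUnique_orth x).unique (oplus_comm' hbx) (oplus_comm' hby)

theorem eq_zero_of_oplus_eq_right {a b : M} (H : IsEffectAlgebra one)
    (h : PCM.oplus a b = some b) : a = 0 :=
  H.cancel (oplus_comm' h) (oplus_zero b)

theorem eq_zero_of_oplus_eq_zero {a b : M} (H : IsEffectAlgebra one)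
    (h : PCM.oplus a b = some 0) : a = 0 := by
  obtain ⟨x, hx, _⟩ := PCM.oplus_assoc (oplus_comm' h) (PCM.zero_oplus one)
  exact H.zero_one a ⟨x, hx⟩

theorem eq_zero_of_ple_zero {a : M} (H : IsEffectAlgebra one) (h : PLe a 0) : a = 0 := by
  obtain ⟨_, h⟩ := h
  exact H.eq_zero_of_oplus_eq_zero h

theorem antisymm {a b : M} (H : IsEffectAlgebra one) : PLe a b → PLe b a → a = b := by
  rintro ⟨x, hx⟩ ⟨y, hy⟩
  obtain ⟨z, hz, haz⟩ := PCM.oplus_assoc hx hy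
  obtain rfl := H.eq_zero_of_oplus_eq_right (oplus_comm' haz)
  obtain rfl := H.eq_zero_of_oplus_eq_zero hz
  rw [oplus_zero] at hx
  exact Option.some.inj hx

end IsEffectAlgebra

end PCM

/-! ### Effectuses in partial form -/

/-- An effectus in partial form: a category with finite coproducts, enriched over PCMs
(the neutral element of the PCM of maps `X ⟶ Y` being the zero map), satisfying the compatible sum axiom and the untying
axiom, and with a distinguished object `I` such that all `X ⟶ I` are effect algebras. -/
class Effectus (C : Type u) [Category.{v} C] [HasZeroMorphisms C] [HasFiniteCoproducts C] where
  pcm : ∀ X Y : C, PCM (X ⟶ Y)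
  oplus_comp : ∀ {X Y Z : C} {f g s : X ⟶ Y} (h : Y ⟶ Z), PCM.oplus f g = some s →
    PCM.oplus (f ≫ h) (g ≫ h) = some (s ≫ h)
  comp_oplus : ∀ {X Y Z : C} {f g s : Y ⟶ Z} (k : X ⟶ Y), PCM.oplus f g = some s →
    PCM.oplus (k ≫ f) (k ≫ g) = some (k ≫ s)
  compatible_sum : ∀ {X Y : C} (b : X ⟶ Y ⨿ Y),
    Perp (b ≫ coprod.desc (𝟙 Y) 0) (b ≫ coprod.desc 0 (𝟙 Y))
  untying : ∀ {X Y : C} {f g : X ⟶ Y}, Perp f g →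
    Perp (f ≫ (coprod.inl : Y ⟶ Y ⨿ Y)) (g ≫ (coprod.inr : Y ⟶ Y ⨿ Y))
  I : C
  truth : ∀ X : C, X ⟶ I
  isEffectAlgebra : ∀ X : C, IsEffectAlgebra (truth X)
  perp_of_truth : ∀ {X Y : C} {f g : X ⟶ Y}, Perp (f ≫ truth Y) (g ≫ truth Y) → Perp f g
  eq_zero_of_truth : ∀ {X Y : C} {f : X ⟶ Y}, f ≫ truth Y = 0 → f = 0

attribute [instance, reducible] Effectus.pcm

variable {C : Type u} [Category.{v} C] [HasZeroMorphisms C] [HasFiniteCoproducts C] [Effectus C]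

/-- Predicates on `X`. -/
abbrev Pred (X : C) : Type v := X ⟶ (Effectus.I : C)

/-- The predicate `1` on `X`; thus `f ≫ truth Y` is the predicate `1 ∘ f`. -/
abbrev truth (X : C) : Pred X := Effectus.truth X

/-- The orthocomplement of a predicate. -/
noncomputable def orth {X : C} (p : Pred X) : Pred X :=
  ((Effectus.isEffectAlgebra X).existsUnique_orth p).choose

theorem oplus_orth {X : C} (p : Pred X) : PCM.oplus p (orth p) = some (truth X) :=
  ((Effectus.isEffectAlgebra X).existsUnique_orth p).choose_spec.1

theorem eq_orth {X : C} {p q : Pred X} (h : PCM.oplus p q = some (truth X)) : q = orth p :=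
  ((Effectus.isEffectAlgebra X).existsUnique_orth p).unique h (oplus_orth p)

theorem orth_orth {X : C} (p : Pred X) : orth (orth p) = p :=
  (eq_orth (oplus_comm' (oplus_orth p))).symm

theorem ple_orth_of_ple_orth {X : C} {p q : Pred X} (h : PLe p (orth q)) : PLe q (orth p) := by
  obtain ⟨r, hr⟩ := h
  obtain ⟨x, hx, hpx⟩ := PCM.oplus_assoc hr (oplus_comm' (oplus_orth q))
  exact ⟨r, by rw [← eq_orth hpx]; exact oplus_comm' hx⟩

theorem comp_orth_eq_zero {X Y : C} {f : X ⟶ Y} {p : Pred Y} (h : f ≫ p = f ≫ truth Y) :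
    f ≫ orth p = 0 := by
  have h1 := Effectus.comp_oplus f (oplus_orth p)
  rw [h] at h1
  exact (Effectus.isEffectAlgebra X).eq_zero_of_oplus_eq_right (oplus_comm' h1)

theorem comp_orth_eq_truth {X Y : C} {f : X ⟶ Y} {p : Pred Y} (h : f ≫ p = 0) :
    f ≫ orth p = f ≫ truth Y := by
  have h1 := Effectus.comp_oplus f (oplus_orth p)
  rw [h, PCM.zero_oplus] at h1
  exact Option.some.inj h1

/-! ### Quotients, comprehensions, purity and images -/

/-- `ξ` is a quotient for the predicate `p`. -/
def IsQuotientFor {X Q : C} (ξ : X ⟶ Q) (p : Pred X) : Prop :=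
  PLe (ξ ≫ truth Q) (orth p) ∧
    ∀ {Y : C} (f : X ⟶ Y), PLe (f ≫ truth Y) (orth p) → ∃! f' : Q ⟶ Y, ξ ≫ f' = f

/-- `π` is a comprehension for the predicate `p`. -/
def IsComprehensionFor {K X : C} (π : K ⟶ X) (p : Pred X) : Prop :=
  π ≫ p = π ≫ truth X ∧
    ∀ {Z : C} (g : Z ⟶ X), g ≫ p = g ≫ truth X → ∃! g' : Z ⟶ K, g' ≫ π = g

def IsQuotient {X Q : C} (ξ : X ⟶ Q) : Prop := ∃ p, IsQuotientFor ξ p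

def IsComprehension {K X : C} (π : K ⟶ X) : Prop := ∃ p, IsComprehensionFor π p

/-- A map is pure if it is a quotient followed by a comprehension. -/
def IsPure {X Y : C} (f : X ⟶ Y) : Prop :=
  ∃ (Z : C) (ξ : X ⟶ Z) (π : Z ⟶ Y), IsQuotient ξ ∧ IsComprehension π ∧ f = ξ ≫ π

/-- `p` is the image of `f`: the least predicate with `p ∘ f = 1 ∘ f`. -/
def IsImage {X Y : C} (f : X ⟶ Y) (p : Pred Y) : Prop :=
  f ≫ p = f ≫ truth Y ∧ ∀ q : Pred Y, f ≫ q = f ≫ truth Y → PLe p q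

/-- A predicate is sharp if it is the image of some map. -/
def IsSharp {X : C} (p : Pred X) : Prop := ∃ (W : C) (f : W ⟶ X), IsImage f p

/-- A quotient of a sharp predicate. -/
def IsSharpQuotient {X Q : C} (ξ : X ⟶ Q) : Prop := ∃ p, IsSharp p ∧ IsQuotientFor ξ p

variable (C) in
class HasQuotients : Prop where
  exists_quotient : ∀ {X : C} (p : Pred X), ∃ (Q : C) (ξ : X ⟶ Q), IsQuotientFor ξ p

variable (C) in
class HasComprehension : Prop where
  exists_comprehension : ∀ {X : C} (p : Pred X), ∃ (K : C) (π : K ⟶ X), IsComprehensionFor π p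

variable (C) in
class HasPredImages : Prop where
  exists_image : ∀ {X Y : C} (f : X ⟶ Y), ∃ p : Pred Y, IsImage f p

section Images

variable [HasPredImages C]

/-- The image of `f`. -/
noncomputable def im {X Y : C} (f : X ⟶ Y) : Pred Y := (HasPredImages.exists_image f).choose

theorem isImage_im {X Y : C} (f : X ⟶ Y) : IsImage f (im f) :=
  (HasPredImages.exists_image f).choose_spec

end Images

section Comprehension

variable [HasComprehension C]

/-- The domain of a chosen comprehension of `p`. -/
noncomputable def comprObj {X : C} (p : Pred X) : C :=
  (HasComprehension.exists_comprehension p).choose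

/-- A chosen comprehension `π_p` of `p`. -/
noncomputable def compr {X : C} (p : Pred X) : comprObj p ⟶ X :=
  (HasComprehension.exists_comprehension p).choose_spec.choose

theorem isComprehensionFor_compr {X : C} (p : Pred X) : IsComprehensionFor (compr p) p :=
  (HasComprehension.exists_comprehension p).choose_spec.choose_spec

variable [HasPredImages C]

/-- `⌊p⌋`, the image of a comprehension of `p`. -/
noncomputable def floor {X : C} (p : Pred X) : Pred X := im (compr p)

/-- `⌈p⌉ = ⌊p^⊥⌋^⊥`. -/
noncomputable def ceil {X : C} (p : Pred X) : Pred X := orth (floor (orth p))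

end Comprehension

/-! ### The poset of sharp predicates -/

/-- The sharp predicates on `X`. -/
def SPred (X : C) : Type v := {p : Pred X // IsSharp p}

instance (X : C) : PartialOrder (SPred X) where
  le s t := PLe s.1 t.1
  le_refl s := PLe.refl s.1
  le_trans _ _ _ h h' := PLe.trans h h'
  le_antisymm _ _ h h' := Subtype.ext ((Effectus.isEffectAlgebra X).antisymm h h')

theorem isSharp_zero (X : C) : IsSharp (0 : Pred X) :=
  ⟨X, 0, by simp, fun q _ => zero_ple q⟩

instance (X : C) : Zero (SPred X) := ⟨⟨0, isSharp_zero X⟩⟩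

/-! ### Diamond-effectuses -/

variable (C) in
/-- A `⋄`-effectus. -/
class DiamondEffectus : Prop extends HasQuotients C, HasComprehension C, HasPredImages C where
  isSharp_orth : ∀ {X : C} {s : Pred X}, IsSharp s → IsSharp (orth s)

section Diamond

variable [DiamondEffectus C]

/-- The image of a map, as a sharp predicate. -/
noncomputable def imS {X Y : C} (f : X ⟶ Y) : SPred Y := ⟨im f, X, f, isImage_im f⟩

noncomputable def orthS {X : C} (s : SPred X) : SPred X :=
  ⟨orth s.1, DiamondEffectus.isSharp_orth s.2⟩

/-- The ceiling of a predicate, as a sharp predicate. -/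
noncomputable def ceilS {X : C} (p : Pred X) : SPred X :=
  ⟨ceil p, DiamondEffectus.isSharp_orth (imS (compr (orth p))).2⟩

/-- `f^⋄(s) = ⌈s ∘ f⌉`. -/
noncomputable def diaUp {X Y : C} (f : X ⟶ Y) (s : SPred Y) : SPred X := ceilS (f ≫ s.1)

/-- `f_⋄(s) = im (f ∘ π_s)`. -/
noncomputable def diaDown {X Y : C} (f : X ⟶ Y) (s : SPred X) : SPred Y := imS (compr s.1 ≫ f)

/-- `f^□(s) = f^⋄(s^⊥)^⊥`. -/
noncomputable def boxUp {X Y : C} (f : X ⟶ Y) (s : SPred Y) : SPred X :=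
  orthS (diaUp f (orthS s))

/-- `f` is `⋄`-adjoint to `g`. -/
def DiamondAdjoint {X Y : C} (f : X ⟶ Y) (g : Y ⟶ X) : Prop := diaUp f = diaDown g

/-- A pure endomap is `⋄`-positive if it is the square of a `⋄`-self-adjoint map. -/
def DiamondPositive {X : C} (f : X ⟶ X) : Prop :=
  IsPure f ∧ ∃ g : X ⟶ X, DiamondAdjoint g g ∧ f = g ≫ g

end Diamond

/-! ### Andthen-effectuses and dagger-effectuses -/

variable (C) in
/-- An `&`-effectus. -/
class AndThenEffectus : Prop extends DiamondEffectus C where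
  existsUnique_asrt : ∀ {X : C} (p : Pred X),
    ∃! f : X ⟶ X, DiamondPositive f ∧ f ≫ truth X = p
  isPure_comp : ∀ {X Y Z : C} (π : X ⟶ Y) (ξ : Y ⟶ Z), IsComprehension π → IsQuotient ξ →
    IsPure (π ≫ ξ)

section AndThen

variable [AndThenEffectus C]

/-- `asrt_p`, the unique `⋄`-positive map with `1 ∘ asrt_p = p`. -/
noncomputable def asrt {X : C} (p : Pred X) : X ⟶ X :=
  (AndThenEffectus.existsUnique_asrt p).choose

theorem isPure_asrt {X : C} (p : Pred X) : IsPure (asrt p) :=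
  (AndThenEffectus.existsUnique_asrt p).choose_spec.1.1.1

end AndThen

/-- Pure maps. -/
def PureHom (X Y : C) : Type v := {f : X ⟶ Y // IsPure f}

/-- Given an operation `dag` on pure maps, `f` is `†`-positive if `f = g^† ∘ g` for some
pure map `g`. -/
def DaggerPositive (dag : ∀ {X Y : C}, PureHom X Y → PureHom Y X) {X : C} (f : X ⟶ X) : Prop :=
  ∃ (Y : C) (g : PureHom X Y), f = g.1 ≫ (dag g).1

variable (C) in
/-- A `†`-effectus. The pure maps of an `&`-effectus form a subcategory; the laws of the dagger
quantify over all proofs that the composites and identities in question are pure. -/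
class DaggerEffectus extends AndThenEffectus C where
  dag : ∀ {X Y : C}, PureHom X Y → PureHom Y X
  dag_comp : ∀ {X Y Z : C} (f : PureHom X Y) (g : PureHom Y Z) (h : IsPure (f.1 ≫ g.1)),
    (dag ⟨f.1 ≫ g.1, h⟩).1 = (dag g).1 ≫ (dag f).1
  dag_id : ∀ {X : C} (h : IsPure (𝟙 X)), (dag ⟨𝟙 X, h⟩).1 = 𝟙 X
  dag_dag : ∀ {X Y : C} (f : PureHom X Y), dag (dag f) = f
  dag_asrt : ∀ {X : C} (p : Pred X), (dag ⟨asrt p, isPure_asrt p⟩).1 = asrt p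
  diamondAdjoint_dag : ∀ {X Y : C} (f : PureHom X Y), DiamondAdjoint f.1 (dag f).1
  existsUnique_sqrt : ∀ {X : C} (f : X ⟶ X), DaggerPositive dag f →
    ∃! g : X ⟶ X, DaggerPositive dag g ∧ g ≫ g = f
  daggerPositive_of_diamondPositive : ∀ {X : C} (f : X ⟶ X),
    DiamondPositive f → DaggerPositive dag f

/-! ### Kernels and cokernels -/

/-- A comprehension for `(1 ∘ f)^⊥` is a kernel of `f`. -/
theorem isKernel_of_isComprehensionFor {K X Y : C} {π : K ⟶ X} {f : X ⟶ Y}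
    (h : IsComprehensionFor π (orth (f ≫ truth Y))) :
    ∃ w : π ≫ f = 0, Nonempty (IsLimit (KernelFork.ofι π w)) := by
  have w : π ≫ f = 0 := Effectus.eq_zero_of_truth (by
    have := comp_orth_eq_zero h.1
    rwa [orth_orth, ← Category.assoc] at this)
  have key : ∀ {Z : C} (g : Z ⟶ X), g ≫ f = 0 → ∃! g' : Z ⟶ K, g' ≫ π = g := fun g hg =>
    h.2 g (comp_orth_eq_truth (by rw [← Category.assoc, hg, zero_comp]))
  refine ⟨w, ⟨KernelFork.IsLimit.ofι π w (fun g hg => (key g hg).choose)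
    (fun g hg => (key g hg).choose_spec.1) (fun g hg m hm => ?_)⟩⟩
  exact (key g hg).unique hm (key g hg).choose_spec.1

instance [HasComprehension C] : HasKernels C where
  has_limit f := by
    obtain ⟨_, ⟨l⟩⟩ := isKernel_of_isComprehensionFor (f := f) (isComprehensionFor_compr _)
    exact ⟨⟨_, l⟩⟩

/-- A quotient for the image of `f` is a cokernel of `f`. -/
theorem isCokernel_of_isQuotientFor {X Y Q : C} {f : X ⟶ Y} {ξ : Y ⟶ Q} {p : Pred Y}
    (hp : IsImage f p) (h : IsQuotientFor ξ p) :
    ∃ w : f ≫ ξ = 0, Nonempty (IsColimit (CokernelCofork.ofπ ξ w)) := by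
  have w : f ≫ ξ = 0 := Effectus.eq_zero_of_truth (by
    obtain ⟨r, hr⟩ := h.1
    have h1 := Effectus.comp_oplus f hr
    rw [comp_orth_eq_zero hp.1] at h1
    rw [Category.assoc]
    exact (Effectus.isEffectAlgebra X).eq_zero_of_oplus_eq_zero h1)
  have key : ∀ {Z : C} (g : Y ⟶ Z), f ≫ g = 0 → ∃! g' : Q ⟶ Z, ξ ≫ g' = g := fun g hg =>
    h.2 g (ple_orth_of_ple_orth (hp.2 _ (comp_orth_eq_truth
      (by rw [← Category.assoc, hg, zero_comp]))))
  refine ⟨w, ⟨CokernelCofork.IsColimit.ofπ ξ w (fun g hg => (key g hg).choose)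
    (fun g hg => (key g hg).choose_spec.1) (fun g hg m hm => ?_)⟩⟩
  exact (key g hg).unique hm (key g hg).choose_spec.1

instance [HasQuotients C] [HasPredImages C] : HasCokernels C where
  has_colimit f := by
    obtain ⟨_, ξ, hξ⟩ := HasQuotients.exists_quotient (im f)
    obtain ⟨_, ⟨l⟩⟩ := isCokernel_of_isQuotientFor (isImage_im f) hξ
    exact ⟨⟨_, l⟩⟩

end EffectusTheory

/-! ### Homological notions in a pointed semiexact category -/

namespace Semiexact

variable {C : Type u} [Category.{v} C] [HasZeroMorphisms C]

/-- `m` is a kernel of some map. -/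
def IsAKernel {K X : C} (m : K ⟶ X) : Prop :=
  ∃ (Y : C) (f : X ⟶ Y) (w : m ≫ f = 0), Nonempty (IsLimit (KernelFork.ofι m w))

/-- `q` is a cokernel of some map. -/
def IsACokernel {Y Q : C} (q : Y ⟶ Q) : Prop :=
  ∃ (X : C) (f : X ⟶ Y) (w : f ≫ q = 0), Nonempty (IsColimit (CokernelCofork.ofπ q w))

variable [HasKernels C] [HasCokernels C]

/-- `A ⟶ B ⟶ C` is exact at `B` if `ker (cok f)` and `ker g` agree as subobjects of `B`. -/
def ExactAt {A B D : C} (f : A ⟶ B) (g : B ⟶ D) : Prop :=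
  kernelSubobject (cokernel.π f) = kernelSubobject g

/-- The poset of normal subobjects of `A`: the kernels into `A`, modulo mutual factorization. -/
def Nsb (A : C) : Type (max u v) :=
  {S : Subobject A // ∃ (B : C) (f : A ⟶ B), S = kernelSubobject f}

instance (A : C) : PartialOrder (Nsb A) := inferInstanceAs (PartialOrder (Subtype _))

/-- The kernel of `f` as a normal subobject. -/
noncomputable def Nsb.ker {A B : C} (f : A ⟶ B) : Nsb A := ⟨kernelSubobject f, B, f, rfl⟩

/-- The least normal subobject `0`, which is the kernel of the identity. -/
noncomputable def Nsb.zero (A : C) : Nsb A := Nsb.ker (𝟙 A)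

/-- The greatest normal subobject `1`, represented by the identity, a kernel of the zero map. -/
noncomputable def Nsb.one (A : C) : Nsb A := ⟨⊤, A, 0, kernelSubobject_zero.symm⟩

/-- `f_*(k) = ker (cok (f ∘ k))`. -/
noncomputable def directImage {A B : C} (f : A ⟶ B) (k : Nsb A) : Nsb B :=
  Nsb.ker (cokernel.π (k.1.arrow ≫ f))

/-- `f^*(k) = ker (cok k ∘ f)`. -/
noncomputable def inverseImage {A B : C} (f : A ⟶ B) (k : Nsb B) : Nsb A :=
  Nsb.ker (f ≫ cokernel.π k.1.arrow)

/-- `f` is left-modular at `k`: `f^*(f_*(k)) = k ∨ f^*(0)`. -/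
def LeftModularAt {A B : C} (f : A ⟶ B) (k : Nsb A) : Prop :=
  IsLUB {k, inverseImage f (Nsb.zero B)} (inverseImage f (directImage f k))

/-- `f` is right-modular at `k`: `f_*(f^*(k)) = k ∧ f_*(1)`. -/
def RightModularAt {A B : C} (f : A ⟶ B) (k : Nsb B) : Prop :=
  IsGLB {k, directImage f (Nsb.one A)} (directImage f (inverseImage f k))

end Semiexact

namespace EffectusTheory

open Semiexact

variable {C : Type u} [Category.{v} C] [HasZeroMorphisms C] [HasFiniteCoproducts C] [Effectus C]

instance mono_compr [HasComprehension C] {X : C} (p : Pred X) : Mono (compr p) where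
  right_cancellation g h e := by
    refine ((isComprehensionFor_compr p).2 (g ≫ compr p) ?_).unique rfl e.symm
    rw [Category.assoc, Category.assoc, (isComprehensionFor_compr p).1]

theorem truth_I : truth (Effectus.I : C) = 𝟙 _ := by
  have h := Effectus.oplus_comp (truth (Effectus.I : C)) (oplus_orth (𝟙 (Effectus.I : C)))
  rw [Category.id_comp] at h
  have h0 : orth (𝟙 (Effectus.I : C)) ≫ truth _ = 0 :=
    (Effectus.isEffectAlgebra _).zero_one _ ⟨_, oplus_comm' (c := truth _ ≫ truth _) h⟩
  have h1 := oplus_orth (𝟙 (Effectus.I : C))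
  rw [Effectus.eq_zero_of_truth h0, oplus_zero] at h1
  exact (Option.some.inj h1).symm

theorem mk_compr_eq_kernelSubobject [HasComprehension C] {X : C} (p : Pred X) :
    Subobject.mk (compr p) = kernelSubobject (orth p) := by
  have e : orth (orth p ≫ truth (Effectus.I : C)) = p := by
    rw [truth_I, Category.comp_id, orth_orth]
  obtain ⟨w, ⟨l⟩⟩ := isKernel_of_isComprehensionFor (f := orth p) (π := compr p)
    (by rw [e]; exact isComprehensionFor_compr p)
  apply le_antisymm
  · exact Subobject.mk_le_of_comm (factorThruKernelSubobject _ (compr p) w) (by simp)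
  · exact Subobject.le_mk_of_comm
      (l.lift (KernelFork.ofι (kernelSubobject (orth p)).arrow (by simp)))
      (Fork.IsLimit.lift_ι l)

/-- The normal subobject represented by a comprehension `π_s` of the sharp predicate `s`. -/
noncomputable def SPred.nsb [HasComprehension C] {X : C} (s : SPred X) : Nsb X :=
  ⟨Subobject.mk (compr s.1), _, orth s.1, mk_compr_eq_kernelSubobject s.1⟩

section Snake

variable [DiamondEffectus C] {A B D A' B' D' : C}

/-- The hypotheses of the snake lemma on the rows `A ⟶ B ⟶ D ⟶ 0` and `0 ⟶ A' ⟶ B' ⟶ D'`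
and on the vertical map `b : B ⟶ B'`. -/
structure SnakeHypotheses (f : A ⟶ B) (g : B ⟶ D) (h : A' ⟶ B') (k : B' ⟶ D')
    (b : B ⟶ B') : Prop where
  exact_B : ExactAt f g
  exact_D : ExactAt g (0 : D ⟶ ⊥_ C)
  exact_A' : ExactAt (0 : ⊥_ C ⟶ A') h
  exact_B' : ExactAt h k
  isACokernel_g : IsACokernel g
  isAKernel_h : IsAKernel h
  leftModular_b : LeftModularAt b (imS f).nsb
  rightModular_b : RightModularAt b (imS h).nsb
  rightModular_f : RightModularAt f (orthS (ceilS (b ≫ truth B'))).nsb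
  leftModular_k : LeftModularAt k (imS b).nsb

/-- The reformulation of the hypotheses of the snake lemma in terms of sharp predicates. -/
structure SnakeConditions (f : A ⟶ B) (g : B ⟶ D) (h : A' ⟶ B') (k : B' ⟶ D')
    (b : B ⟶ B') : Prop where
  box_dia_b : IsLUB {orthS (ceilS (b ≫ truth B')), imS f} (boxUp b (diaDown b (imS f)))
  dia_box_b : IsGLB {imS h, imS b} (diaDown b (boxUp b (imS h)))
  box_dia_k : IsLUB {imS h, imS b} (boxUp k (diaDown k (imS b)))
  dia_box_f : IsGLB {orthS (ceilS (b ≫ truth B')), imS f} (diaDown f (boxUp f (boxUp b 0)))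
  orth_im_f : orth (im f) = ceil (g ≫ truth D)
  orth_im_h : orth (im h) = ceil (k ≫ truth D')
  isSharpQuotient_g : IsSharpQuotient g
  isComprehension_h : IsComprehension h

end Snake

end EffectusTheory

open EffectusTheory Semiexact

namespace EffectusTheory

variable {C : Type u} [Category.{v} C] [HasZeroMorphisms C] [HasFiniteCoproducts C] [Effectus C]

/-! ### Predicates and maps -/

/-! Kernels are exactly comprehensions and cokernels are exactly sharp quotients. Hence `s ↦ s.nsb`
identifies sharp predicates with normal subobjects (`nsbIso`). Under it direct image becomes
`diaDown f`, inverse image becomes `boxUp f`, and exactness becomes `imS f = kerS g`. This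
translation gives the first claim, and the rest is a computation in the lattices `SPred X`. These
are orthomodular (`sup_orthS_inf`), and `diaDown f` is left adjoint to `boxUp f`.

The dagger enters through splittings. For sharp `s` the map `asrt s.1` is an idempotent of the form
quotient ≫ comprehension, and it is its own dagger. It follows (`adj_eq_of_asrt`) that the dagger of
a comprehension retracts it, and that the dagger of a sharp quotient is a comprehension and a
section. The second claim follows by cancelling `kernel.ι` or `cokernel.π` against its dagger.

For the third claim the connecting map is `kernel.ι c ≫ g† ≫ b ≫ h† ≫ cokernel.π a`. Each exactness
equation is tested in `SPred B` or `SPred B'`, after applying `diaDown` of comprehensions or `boxUp`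
of sharp quotients, which are injective. There the daggers of `g` and `h` act as Sasaki projections,
which the orthomodular law removes because `imS f ≤ boxUp b (imS h)`. What remains at each of the
four places is one of the four modularity hypotheses. -/

theorem ple_antisymm {X : C} {p q : Pred X} (h : PLe p q) (h' : PLe q p) : p = q :=
  (Effectus.isEffectAlgebra X).antisymm h h'

theorem ple_truth {X : C} (p : Pred X) : PLe p (truth X) := ⟨_, oplus_orth p⟩

theorem eq_zero_of_ple_zero {X : C} {p : Pred X} (h : PLe p 0) : p = 0 :=
  (Effectus.isEffectAlgebra X).eq_zero_of_ple_zero h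

theorem comp_ple_comp {X Y : C} (f : X ⟶ Y) {p q : Pred Y} (h : PLe p q) :
    PLe (f ≫ p) (f ≫ q) := by
  obtain ⟨r, hr⟩ := h
  exact ⟨f ≫ r, Effectus.comp_oplus f hr⟩

theorem orth_ple_orth {X : C} {p q : Pred X} (h : PLe p q) : PLe (orth q) (orth p) :=
  ple_orth_of_ple_orth (by rwa [orth_orth])

theorem orth_ple_orth_iff {X : C} {p q : Pred X} : PLe (orth q) (orth p) ↔ PLe p q :=
  ⟨fun h => by simpa only [orth_orth] using orth_ple_orth h, orth_ple_orth⟩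

theorem orth_zero (X : C) : orth (0 : Pred X) = truth X := (eq_orth (PCM.zero_oplus _)).symm

theorem orth_truth (X : C) : orth (truth X) = 0 := by rw [← orth_zero, orth_orth]

theorem comp_eq_truth_iff {X Y : C} {f : X ⟶ Y} {p : Pred Y} :
    f ≫ p = f ≫ truth Y ↔ f ≫ orth p = 0 :=
  ⟨comp_orth_eq_zero, fun h => by simpa only [orth_orth] using comp_orth_eq_truth h⟩

theorem comp_truth_eq_zero_iff {X Y : C} {f : X ⟶ Y} : f ≫ truth Y = 0 ↔ f = 0 :=
  ⟨Effectus.eq_zero_of_truth, fun h => by rw [h, zero_comp]⟩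

theorem comp_orth_comp_truth_iff {X Y Z : C} {g : X ⟶ Y} {f : Y ⟶ Z} :
    g ≫ orth (f ≫ truth Z) = g ≫ truth Y ↔ g ≫ f = 0 := by
  rw [comp_eq_truth_iff, orth_orth, ← Category.assoc, comp_truth_eq_zero_iff]

theorem comp_eq_truth_of_ple {X Y : C} {f : X ⟶ Y} {p q : Pred Y} (hpq : PLe p q)
    (h : f ≫ p = f ≫ truth Y) : f ≫ q = f ≫ truth Y :=
  ple_antisymm (comp_ple_comp f (ple_truth q)) (h ▸ comp_ple_comp f hpq)

theorem comp_eq_zero_of_ple {X Y : C} {f : X ⟶ Y} {p q : Pred Y} (hpq : PLe p q)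
    (h : f ≫ q = 0) : f ≫ p = 0 :=
  eq_zero_of_ple_zero (h ▸ comp_ple_comp f hpq)

theorem pred_comp_truth {X : C} (p : Pred X) : p ≫ truth Effectus.I = p := by
  rw [truth_I, Category.comp_id]

/-- If `f ≫ g` is total then so is `f`. -/
theorem comp_truth_of_comp {X Y Z : C} {f : X ⟶ Y} {g : Y ⟶ Z}
    (h : (f ≫ g) ≫ truth Z = truth X) : f ≫ truth Y = truth X :=
  ple_antisymm (ple_truth _) (by
    rw [← h, Category.assoc]
    exact comp_ple_comp f (ple_truth _))

/-! ### Quotients -/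

section Quotients

variable {X Q : C} {ξ : X ⟶ Q} {p : Pred X}

theorem IsQuotientFor.comp_truth (h : IsQuotientFor ξ p) : ξ ≫ truth Q = orth p := by
  refine ple_antisymm h.1 ?_
  obtain ⟨f', hf, -⟩ := h.2 (orth p) (by rw [pred_comp_truth]; exact PLe.refl _)
  rw [← hf]
  exact comp_ple_comp ξ (ple_truth _)

theorem IsQuotientFor.epi (h : IsQuotientFor ξ p) : Epi ξ where
  left_cancellation {Z} a b e := by
    refine (h.2 (ξ ≫ b) ?_).unique e rfl
    rw [Category.assoc]
    exact (comp_ple_comp ξ (ple_truth _)).trans h.1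

/-- The difference `r` of the two composites lies below `ξ ≫ truth Q`, so it factors as `ξ ≫ r'`.
Untying encodes the sum as one map into `I ⨿ I`, which also factors through `ξ`. The compatible sum
axiom for the factor then makes `x` and `r'` summable, and since `ξ` is epi the sum is `y`. -/
theorem IsQuotientFor.ple_of_comp_ple (h : IsQuotientFor ξ p) {x y : Pred Q}
    (hxy : PLe (ξ ≫ x) (ξ ≫ y)) : PLe x y := by
  have := h.epi
  obtain ⟨r, hr⟩ := hxy
  have hle : PLe (ξ ≫ y) (orth p) := (comp_ple_comp ξ (ple_truth y)).trans h.1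
  obtain ⟨r', rfl, -⟩ := h.2 r (by
    rw [pred_comp_truth]; exact PLe.trans ⟨_, oplus_comm' hr⟩ hle)
  obtain ⟨m, hm⟩ := Effectus.untying ⟨_, hr⟩
  -- Coprojections are split mono, hence total. So `m` has the same truth value as the original sum,
  -- namely `ξ ≫ y`.
  have hinl : (coprod.inl : (Effectus.I : C) ⟶ Effectus.I ⨿ Effectus.I) ≫ truth _ =
      truth Effectus.I := comp_truth_of_comp (g := coprod.desc (𝟙 _) 0)
      (by rw [coprod.inl_desc, Category.id_comp])
  have hinr : (coprod.inr : (Effectus.I : C) ⟶ Effectus.I ⨿ Effectus.I) ≫ truth _ =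
      truth Effectus.I := comp_truth_of_comp (g := coprod.desc 0 (𝟙 _))
      (by rw [coprod.inr_desc, Category.id_comp])
  have hm1 := Effectus.oplus_comp (truth _) hm
  rw [Category.assoc, Category.assoc (ξ ≫ r'), hinl, hinr, pred_comp_truth, pred_comp_truth,
    hr] at hm1
  obtain ⟨m', rfl, -⟩ := h.2 m (by rw [← Option.some.inj hm1]; exact hle)
  have h1 : m' ≫ coprod.desc (𝟙 _) 0 = x := by
    have := Effectus.oplus_comp (coprod.desc (𝟙 _) 0) hm
    simp only [Category.assoc, coprod.inl_desc, coprod.inr_desc, comp_zero, Category.comp_id,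
      oplus_zero, Option.some.injEq] at this
    exact ((cancel_epi ξ).1 this).symm
  have h2 : m' ≫ coprod.desc 0 (𝟙 _) = r' := by
    have := Effectus.oplus_comp (coprod.desc 0 (𝟙 _)) hm
    simp only [Category.assoc, coprod.inl_desc, coprod.inr_desc, comp_zero, Category.comp_id,
      PCM.zero_oplus, Option.some.injEq] at this
    exact ((cancel_epi ξ).1 this).symm
  obtain ⟨z, hz⟩ := Effectus.compatible_sum m'
  rw [h1, h2] at hz
  have hz' := Effectus.comp_oplus ξ hz
  rw [hr] at hz'
  obtain rfl := (cancel_epi ξ).1 (Option.some.inj hz')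
  exact ⟨r', hz⟩

theorem IsQuotientFor.comp (h : IsQuotientFor ξ p) {R : C} {ζ : Q ⟶ R} {q : Pred Q}
    (h' : IsQuotientFor ζ q) : IsQuotientFor (ξ ≫ ζ) (orth (ξ ≫ orth q)) := by
  have := h.epi
  have := h'.epi
  refine ⟨by rw [orth_orth, Category.assoc, h'.comp_truth]; exact PLe.refl _, fun f hf => ?_⟩
  rw [orth_orth] at hf
  obtain ⟨f', rfl, -⟩ := h.2 f (hf.trans ((comp_ple_comp ξ (ple_truth _)).trans h.1))
  rw [Category.assoc] at hf
  obtain ⟨f'', rfl, -⟩ := h'.2 f' (h.ple_of_comp_ple hf)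
  exact ⟨f'', Category.assoc _ _ _, fun y hy => (cancel_epi (ξ ≫ ζ)).1
    (by rw [hy, Category.assoc])⟩

theorem isQuotientFor_of_isIso {X Y : C} (e : X ⟶ Y) [IsIso e] : IsQuotientFor e 0 := by
  refine ⟨by rw [orth_zero]; exact ple_truth _, fun f _ => ⟨inv e ≫ f, by simp, fun y hy => ?_⟩⟩
  rw [← hy, IsIso.inv_hom_id_assoc]

theorem IsQuotientFor.comp_isIso (h : IsQuotientFor ξ p) {R : C} (e : Q ⟶ R) [IsIso e] :
    IsQuotientFor (ξ ≫ e) p := by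
  have := h.comp (isQuotientFor_of_isIso e)
  rwa [orth_zero, h.comp_truth, orth_orth] at this

theorem IsQuotientFor.exists_iso (h : IsQuotientFor ξ p) {R : C} {ζ : X ⟶ R}
    (h' : IsQuotientFor ζ p) : ∃ e : Q ≅ R, ξ ≫ e.hom = ζ := by
  have := h.epi
  have := h'.epi
  obtain ⟨a, ha, -⟩ := h.2 ζ h'.1
  obtain ⟨b, hb, -⟩ := h'.2 ξ h.1
  exact ⟨⟨a, b, by rw [← cancel_epi ξ, reassoc_of% ha, hb, Category.comp_id],
    by rw [← cancel_epi ζ, reassoc_of% hb, ha, Category.comp_id]⟩, ha⟩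

theorem IsQuotientFor.isIso (h : IsQuotientFor ξ p) (ht : ξ ≫ truth Q = truth X) : IsIso ξ := by
  have hp : p = 0 := by rw [← orth_orth p, ← h.comp_truth, ht, orth_truth]
  subst hp
  obtain ⟨e, he⟩ := (isQuotientFor_of_isIso (𝟙 X)).exists_iso h
  rw [← he]
  infer_instance

end Quotients

/-! ### Images and comprehensions -/

theorem IsImage.unique {X Y : C} {f : X ⟶ Y} {p q : Pred Y} (hp : IsImage f p)
    (hq : IsImage f q) : p = q :=
  ple_antisymm (hp.2 q hq.1) (hq.2 p hp.1)

section Images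

variable [HasPredImages C]

theorem IsImage.im_eq {X Y : C} {f : X ⟶ Y} {p : Pred Y} (hp : IsImage f p) : im f = p :=
  (isImage_im f).unique hp

theorem im_ple_iff {X Y : C} {f : X ⟶ Y} {q : Pred Y} :
    PLe (im f) q ↔ f ≫ q = f ≫ truth Y :=
  ⟨fun h => comp_eq_truth_of_ple h (isImage_im f).1, (isImage_im f).2 q⟩

theorem comp_eq_zero_iff_ple_orth_im {X Y : C} {f : X ⟶ Y} {q : Pred Y} :
    f ≫ q = 0 ↔ PLe q (orth (im f)) := by
  conv_lhs => rw [← orth_orth q]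
  rw [← comp_eq_truth_iff, ← im_ple_iff, ← orth_ple_orth_iff, orth_orth]

theorem im_epi_comp {X Y Z : C} (e : X ⟶ Y) [Epi e] (f : Y ⟶ Z) : im (e ≫ f) = im f :=
  IsImage.im_eq ⟨by rw [Category.assoc, (isImage_im f).1, Category.assoc], fun q hq =>
    im_ple_iff.2 ((cancel_epi e).1 (by rw [← Category.assoc, hq, Category.assoc]))⟩

theorem im_comp_ple {X Y Z : C} (f : X ⟶ Y) (g : Y ⟶ Z) : PLe (im (f ≫ g)) (im g) :=
  im_ple_iff.2 (by rw [Category.assoc, (isImage_im g).1, Category.assoc])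

theorem im_of_epi {X Y : C} (e : X ⟶ Y) [Epi e] : im e = truth Y :=
  (cancel_epi e).1 (isImage_im e).1

end Images

section Comprehensions

variable {K X : C} {π : K ⟶ X} {p : Pred X}

theorem IsComprehensionFor.mono (h : IsComprehensionFor π p) : Mono π where
  right_cancellation a b e :=
    (h.2 (b ≫ π) (by rw [Category.assoc, Category.assoc, h.1])).unique e rfl

theorem isComprehensionFor_of_isIso {X Y : C} (e : X ⟶ Y) [IsIso e] :
    IsComprehensionFor e (truth Y) :=
  ⟨rfl, fun g _ => ⟨g ≫ inv e, by simp, fun y hy => by rw [← hy]; simp⟩⟩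

theorem IsComprehensionFor.isIso_comp (h : IsComprehensionFor π p) {L : C} (e : L ⟶ K)
    [IsIso e] : IsComprehensionFor (e ≫ π) p := by
  have := h.mono
  refine ⟨by rw [Category.assoc, h.1, Category.assoc], fun g hg => ?_⟩
  obtain ⟨g', rfl, -⟩ := h.2 g hg
  refine ⟨g' ≫ inv e, by simp, fun y hy => ?_⟩
  rw [IsIso.eq_comp_inv, ← cancel_mono π, Category.assoc]
  exact hy

theorem IsComprehensionFor.exists_iso (h : IsComprehensionFor π p) {L : C} {ρ : L ⟶ X}
    (h' : IsComprehensionFor ρ p) : ∃ e : K ≅ L, e.hom ≫ ρ = π := by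
  have := h.mono
  have := h'.mono
  obtain ⟨a, ha, -⟩ := h'.2 π h.1
  obtain ⟨b, hb, -⟩ := h.2 ρ h'.1
  exact ⟨⟨a, b, by rw [← cancel_mono π, Category.assoc, hb, ha, Category.id_comp],
    by rw [← cancel_mono ρ, Category.assoc, ha, hb, Category.id_comp]⟩, ha⟩

/-- Factor `π` through a quotient `ξ` with the same truth value. Since `ξ` is epi, the second factor
still satisfies `p`, so it factors back through `π`. This exhibits a left inverse of `ξ` in
diagrammatic order, `ξ ≫ σ = 𝟙`, which forces `ξ` to be total. -/
theorem IsComprehensionFor.comp_truth [HasQuotients C] (h : IsComprehensionFor π p) :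
    π ≫ truth X = truth K := by
  have := h.mono
  obtain ⟨Q, ξ, hξ⟩ := HasQuotients.exists_quotient (orth (π ≫ truth X))
  have := hξ.epi
  obtain ⟨ρ, hρ, -⟩ := hξ.2 π (by rw [orth_orth]; exact PLe.refl _)
  obtain ⟨σ, rfl, -⟩ := h.2 ρ ((cancel_epi ξ).1 (by rw [reassoc_of% hρ, reassoc_of% hρ, h.1]))
  have hid : ξ ≫ σ = 𝟙 K := by rw [← cancel_mono π, Category.assoc, hρ, Category.id_comp]
  rw [← orth_orth (π ≫ truth X), ← hξ.comp_truth]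
  exact comp_truth_of_comp (g := σ) (by rw [hid, Category.id_comp])

theorem IsComprehensionFor.of_im [HasPredImages C] (h : IsComprehensionFor π p) :
    IsComprehensionFor π (im π) :=
  ⟨(isImage_im π).1, fun g hg => h.2 g (comp_eq_truth_of_ple (im_ple_iff.2 h.1) hg)⟩

theorem IsComprehensionFor.im_eq [HasPredImages C] (h : IsComprehensionFor π p)
    (hp : IsSharp p) : im π = p := by
  refine ple_antisymm (im_ple_iff.2 h.1) ?_
  obtain ⟨W, f, hf⟩ := hp
  obtain ⟨f', rfl, -⟩ := h.2 f hf.1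
  exact hf.im_eq ▸ im_comp_ple f' π

theorem IsComprehensionFor.isIso [HasPredImages C] (h : IsComprehensionFor π p)
    (ht : im π = truth X) : IsIso π := by
  have h' := h.of_im
  rw [ht] at h'
  obtain ⟨e, he⟩ := h'.exists_iso (isComprehensionFor_of_isIso (𝟙 X))
  rw [← he]
  infer_instance

end Comprehensions

/-! ### Kernels are comprehensions and cokernels are quotients -/

theorem isComprehensionFor_of_isKernel {K X Y : C} {m : K ⟶ X} {f : X ⟶ Y} {w : m ≫ f = 0}
    (l : IsLimit (KernelFork.ofι m w)) : IsComprehensionFor m (orth (f ≫ truth Y)) := by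
  refine ⟨comp_orth_comp_truth_iff.2 w, fun g hg => ?_⟩
  obtain ⟨g', hg'⟩ := KernelFork.IsLimit.lift' l g (comp_orth_comp_truth_iff.1 hg)
  exact ⟨g', hg', fun y hy => Fork.IsLimit.hom_ext l (hy.trans hg'.symm)⟩

theorem isQuotientFor_of_isCokernel [HasPredImages C] {X Y Q : C} {f : X ⟶ Y} {q : Y ⟶ Q}
    {w : f ≫ q = 0} (l : IsColimit (CokernelCofork.ofπ q w)) : IsQuotientFor q (im f) := by
  refine ⟨comp_eq_zero_iff_ple_orth_im.1 (by rw [← Category.assoc, w, zero_comp]),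
    fun g hg => ?_⟩
  obtain ⟨g', hg'⟩ := CokernelCofork.IsColimit.desc' l g (Effectus.eq_zero_of_truth
    (by rw [Category.assoc]; exact comp_eq_zero_iff_ple_orth_im.2 hg))
  exact ⟨g', hg', fun y hy => Cofork.IsColimit.hom_ext l (hy.trans hg'.symm)⟩

theorem isComprehensionFor_kernel_ι [HasComprehension C] {X Y : C} (f : X ⟶ Y) :
    IsComprehensionFor (kernel.ι f) (orth (f ≫ truth Y)) :=
  isComprehensionFor_of_isKernel (w := kernel.condition f) (kernelIsKernel f)

theorem isQuotientFor_cokernel_π [HasQuotients C] [HasPredImages C] {X Y : C} (f : X ⟶ Y) :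
    IsQuotientFor (cokernel.π f) (im f) :=
  isQuotientFor_of_isCokernel (w := cokernel.condition f) (cokernelIsCokernel f)

theorem isAKernel_iff_isComprehension {K X : C} {m : K ⟶ X} :
    IsAKernel m ↔ IsComprehension m := by
  refine ⟨fun ⟨_, _, _, ⟨l⟩⟩ => ⟨_, isComprehensionFor_of_isKernel l⟩, fun ⟨p, hp⟩ => ?_⟩
  -- A predicate is itself a map into `I`: the comprehension is the kernel of `orth p`.
  rw [← orth_orth p, ← pred_comp_truth (orth p)] at hp
  exact ⟨_, _, isKernel_of_isComprehensionFor hp⟩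

theorem isACokernel_iff_isSharpQuotient [HasPredImages C] {X Q : C} {ξ : X ⟶ Q} :
    IsACokernel ξ ↔ IsSharpQuotient ξ :=
  ⟨fun ⟨_, f, _, ⟨l⟩⟩ => ⟨im f, ⟨_, f, isImage_im f⟩, isQuotientFor_of_isCokernel l⟩,
    fun ⟨_, ⟨_, f, hf⟩, h⟩ => ⟨_, f, isCokernel_of_isQuotientFor hf h⟩⟩

/-! ### The orthomodular lattice of sharp predicates -/

section Sharp

variable [DiamondEffectus C]

theorem im_compr {X : C} (s : SPred X) : im (compr s.1) = s.1 :=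
  (isComprehensionFor_compr s.1).im_eq s.2

theorem sharp_ple_iff {X : C} {s : SPred X} {p : Pred X} :
    PLe s.1 p ↔ compr s.1 ≫ p = compr s.1 ≫ truth X := by
  rw [← im_ple_iff, im_compr]

theorem sharp_ple_orth_iff {X : C} {s : SPred X} {p : Pred X} :
    PLe s.1 (orth p) ↔ compr s.1 ≫ p = 0 := by
  rw [sharp_ple_iff, comp_eq_truth_iff, orth_orth]

theorem sharp_ple_floor_iff {X : C} {s : SPred X} {p : Pred X} :
    PLe s.1 (floor p) ↔ PLe s.1 p := by
  refine ⟨fun h => h.trans (im_ple_iff.2 (isComprehensionFor_compr p).1), fun h => ?_⟩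
  obtain ⟨g, hg, -⟩ := (isComprehensionFor_compr p).2 (compr s.1) (sharp_ple_iff.1 h)
  rw [← im_compr s, ← hg]
  exact im_comp_ple _ _

theorem comp_floor_eq_truth_iff {X Y : C} {f : X ⟶ Y} {p : Pred Y} :
    f ≫ floor p = f ≫ truth Y ↔ f ≫ p = f ≫ truth Y := by
  rw [← im_ple_iff, ← im_ple_iff]
  exact sharp_ple_floor_iff (s := imS f)

/-- This lets ceilings be dropped whenever only vanishing matters, which is what makes `boxUp` and
`diaDown` computable. -/
theorem comp_ceil_eq_zero_iff {X Y : C} {f : X ⟶ Y} {p : Pred Y} :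
    f ≫ ceil p = 0 ↔ f ≫ p = 0 := by
  have h := comp_floor_eq_truth_iff (f := f) (p := orth p)
  rwa [comp_eq_truth_iff, comp_eq_truth_iff, orth_orth] at h

theorem ceil_ple_iff {X : C} {s : SPred X} {p : Pred X} : PLe (ceil p) s.1 ↔ PLe p s.1 := by
  have h := sharp_ple_floor_iff (s := orthS s) (p := orth p)
  rw [← orth_ple_orth_iff, ceil, orth_orth]
  exact h.trans orth_ple_orth_iff

theorem ceil_eq {X : C} (s : SPred X) : ceilS s.1 = s :=
  le_antisymm (ceil_ple_iff.2 (PLe.refl _)) (ceil_ple_iff.1 (PLe.refl (ceilS s.1).1))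

theorem orthS_orthS {X : C} (s : SPred X) : orthS (orthS s) = s := Subtype.ext (orth_orth _)

theorem orthS_le_orthS {X : C} {s t : SPred X} : orthS s ≤ orthS t ↔ t ≤ s := orth_ple_orth_iff

theorem orthS_le_comm {X : C} {s t : SPred X} : orthS s ≤ t ↔ orthS t ≤ s := by
  rw [← orthS_le_orthS, orthS_orthS]

theorem le_orthS_comm {X : C} {s t : SPred X} : s ≤ orthS t ↔ t ≤ orthS s := by
  rw [← orthS_le_orthS, orthS_orthS]

/-! ### The Galois connection between `diaDown f` and `boxUp f` -/

theorem le_boxUp_iff {X Y : C} {f : X ⟶ Y} {s : SPred X} {t : SPred Y} :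
    s ≤ boxUp f t ↔ compr s.1 ≫ f ≫ orth t.1 = 0 := by
  change PLe s.1 (orth (ceil (f ≫ orth t.1))) ↔ _
  rw [sharp_ple_orth_iff, comp_ceil_eq_zero_iff]

theorem diaDown_le_iff {X Y : C} {f : X ⟶ Y} {s : SPred X} {t : SPred Y} :
    diaDown f s ≤ t ↔ compr s.1 ≫ f ≫ orth t.1 = 0 := by
  change PLe (im (compr s.1 ≫ f)) t.1 ↔ _
  rw [im_ple_iff, comp_eq_truth_iff, Category.assoc]

theorem gc_diaDown_boxUp {X Y : C} (f : X ⟶ Y) :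
    GaloisConnection (diaDown f) (boxUp f) :=
  fun _ _ => diaDown_le_iff.trans le_boxUp_iff.symm

theorem boxUp_comp {X Y Z : C} (f : X ⟶ Y) (g : Y ⟶ Z) (t : SPred Z) :
    boxUp (f ≫ g) t = boxUp f (boxUp g t) := by
  refine eq_of_forall_le_iff fun s => ?_
  rw [le_boxUp_iff, le_boxUp_iff]
  change _ ↔ compr s.1 ≫ f ≫ orth (orth (ceil (g ≫ orth t.1))) = 0
  rw [orth_orth, ← Category.assoc _ f (ceil _), comp_ceil_eq_zero_iff]
  simp only [Category.assoc]

theorem diaDown_comp {X Y Z : C} (f : X ⟶ Y) (g : Y ⟶ Z) (s : SPred X) :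
    diaDown (f ≫ g) s = diaDown g (diaDown f s) := by
  refine eq_of_forall_ge_iff fun t => ?_
  rw [gc_diaDown_boxUp _ _ _, gc_diaDown_boxUp _ _ _, gc_diaDown_boxUp _ _ _, boxUp_comp]

theorem diaUp_eq {X Y : C} (f : X ⟶ Y) (s : SPred Y) :
    diaUp f s = orthS (boxUp f (orthS s)) := by
  rw [boxUp, orthS_orthS, orthS_orthS]

theorem diaUp_comp {X Y Z : C} (f : X ⟶ Y) (g : Y ⟶ Z) (t : SPred Z) :
    diaUp (f ≫ g) t = diaUp f (diaUp g t) := by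
  simp only [diaUp_eq, boxUp_comp, orthS_orthS]

theorem diaUp_id {X : C} (s : SPred X) : diaUp (𝟙 X) s = s := by
  rw [diaUp, Category.id_comp, ceil_eq]

theorem diaDown_id {X : C} (s : SPred X) : diaDown (𝟙 X) s = s := by
  rw [diaDown, Category.comp_id]
  exact Subtype.ext (im_compr s)

/-! ### The lattice of sharp predicates -/

instance (X : C) : BoundedOrder (SPred X) where
  bot := 0
  bot_le s := zero_ple s.1
  top := ⟨truth X, orth_zero X ▸ DiamondEffectus.isSharp_orth (isSharp_zero X)⟩
  le_top s := ple_truth s.1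

theorem orthS_bot (X : C) : orthS (⊥ : SPred X) = ⊤ := Subtype.ext (orth_zero X)

theorem orthS_top (X : C) : orthS (⊤ : SPred X) = ⊥ := Subtype.ext (orth_truth X)

/-- If `x ≤ s`, the comprehension of `x` factors as `g ≫ π`, so `x` is the direct image of `imS g`.
The Galois connection then turns `x ≤ t` into `imS g ≤ boxUp π t`. This constructs binary meets;
joins follow by orthocomplementation. -/
theorem IsComprehensionFor.le_diaDown_boxUp_iff {K X : C} {π : K ⟶ X} {x s t : SPred X}
    (h : IsComprehensionFor π s.1) : x ≤ diaDown π (boxUp π t) ↔ x ≤ s ∧ x ≤ t := by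
  refine ⟨fun hx => ⟨hx.trans ((im_comp_ple _ _).trans (im_ple_iff.2 h.1)),
    hx.trans ((gc_diaDown_boxUp _).l_u_le t)⟩, fun ⟨hs, ht⟩ => ?_⟩
  obtain ⟨g, hg, -⟩ := h.2 (compr x.1) (sharp_ple_iff.1 hs)
  have hx : x = diaDown π (imS g) := by
    refine eq_of_forall_ge_iff fun z => ?_
    rw [gc_diaDown_boxUp _ _ _]
    change PLe _ _ ↔ PLe (im g) (orth (ceil (π ≫ orth z.1)))
    rw [im_ple_iff, comp_eq_truth_iff, orth_orth, comp_ceil_eq_zero_iff, ← Category.assoc, hg,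
      ← sharp_ple_orth_iff, orth_orth]
  have h1 := gc_diaDown_boxUp π (imS g) t
  rw [← hx] at h1
  calc x = diaDown π (imS g) := hx
    _ ≤ _ := (gc_diaDown_boxUp _).monotone_l (h1.1 ht)

theorem le_diaDown_boxUp_compr_iff {X : C} {x s t : SPred X} :
    x ≤ diaDown (compr s.1) (boxUp (compr s.1) t) ↔ x ≤ s ∧ x ≤ t :=
  (isComprehensionFor_compr s.1).le_diaDown_boxUp_iff

noncomputable instance (X : C) : Lattice (SPred X) where
  inf s t := diaDown (compr s.1) (boxUp (compr s.1) t)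
  inf_le_left _ _ := (le_diaDown_boxUp_compr_iff.1 le_rfl).1
  inf_le_right _ _ := (le_diaDown_boxUp_compr_iff.1 le_rfl).2
  le_inf _ _ _ h h' := le_diaDown_boxUp_compr_iff.2 ⟨h, h'⟩
  sup s t := orthS (diaDown (compr (orthS s).1) (boxUp (compr (orthS s).1) (orthS t)))
  le_sup_left _ _ := le_orthS_comm.1 (le_diaDown_boxUp_compr_iff.1 le_rfl).1
  le_sup_right _ _ := le_orthS_comm.1 (le_diaDown_boxUp_compr_iff.1 le_rfl).2
  sup_le _ _ _ h h' := orthS_le_comm.1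
    (le_diaDown_boxUp_compr_iff.2 ⟨orthS_le_orthS.2 h, orthS_le_orthS.2 h'⟩)

theorem IsComprehensionFor.diaDown_boxUp {K X : C} {π : K ⟶ X} {p : Pred X}
    (h : IsComprehensionFor π p) (x : SPred X) : diaDown π (boxUp π x) = x ⊓ imS π :=
  eq_of_forall_le_iff fun z => by
    rw [IsComprehensionFor.le_diaDown_boxUp_iff (s := imS π) h.of_im, le_inf_iff, and_comm]

theorem orthS_sup {X : C} (s t : SPred X) : orthS (s ⊔ t) = orthS s ⊓ orthS t :=
  orthS_orthS _

theorem orthS_inf {X : C} (s t : SPred X) : orthS (s ⊓ t) = orthS s ⊔ orthS t := by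
  rw [← orthS_orthS (orthS s ⊔ orthS t), orthS_sup, orthS_orthS, orthS_orthS]

theorem inf_orthS_self {X : C} (s : SPred X) : s ⊓ orthS s = ⊥ := by
  have h := comp_eq_zero_of_ple (p := truth X) (q := truth X) (PLe.refl _)
    (f := compr (s ⊓ orthS s).1) (by
      rw [← sharp_ple_iff.1 (inf_le_left : s ⊓ orthS s ≤ s)]
      exact sharp_ple_orth_iff.1 (inf_le_right : s ⊓ orthS s ≤ orthS s))
  refine le_bot_iff.1 (sharp_ple_iff.2 ?_)
  rw [h]
  exact comp_zero

/-- The orthomodular law. -/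
theorem sup_orthS_inf {X : C} {s t : SPred X} (h : s ≤ t) : s ⊔ (orthS s ⊓ t) = t := by
  -- Here `d` is the difference between `t` and the join. Its ceiling lies below `orthS s ⊓ t`,
  -- hence below the join, and also below the complement of the join, so `d = 0`.
  obtain ⟨d, hd⟩ : s ⊔ (orthS s ⊓ t) ≤ t := sup_le h inf_le_right
  have hj : PLe d (orth (s ⊔ (orthS s ⊓ t)).1) := by
    obtain ⟨y, hy, hdy⟩ := PCM.oplus_assoc hd (oplus_orth t.1)
    exact ⟨_, by rw [← eq_orth hdy]; exact hy⟩
  have h1 : ceilS d ≤ orthS (s ⊔ (orthS s ⊓ t)) := ceil_ple_iff.2 hj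
  have h2 : ceilS d ≤ t := ceil_ple_iff.2 ⟨_, oplus_comm' hd⟩
  have h3 : ceilS d ≤ orthS s := h1.trans (orthS_le_orthS.2 le_sup_left)
  have h4 : ceilS d ≤ ⊥ := by
    rw [← inf_orthS_self (s ⊔ (orthS s ⊓ t))]
    exact le_inf ((le_inf h3 h2).trans le_sup_right) h1
  have h5 : d = 0 := eq_zero_of_ple_zero (ceil_ple_iff.1 h4)
  rw [h5, oplus_zero] at hd
  exact Subtype.ext (Option.some.inj hd)

/-- The dual form of the orthomodular law. -/
theorem inf_orthS_sup {X : C} {s t : SPred X} (h : s ≤ t) : t ⊓ (orthS t ⊔ s) = s := by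
  have h1 := congrArg orthS (sup_orthS_inf (orthS_le_orthS.2 h))
  rwa [orthS_sup, orthS_inf, orthS_orthS, orthS_orthS] at h1

/-- The kernel of a map, as a sharp predicate. -/
noncomputable def kerS {X Y : C} (f : X ⟶ Y) : SPred X := orthS (ceilS (f ≫ truth Y))

theorem boxUp_bot {X Y : C} (f : X ⟶ Y) : boxUp f ⊥ = kerS f := by
  rw [boxUp, orthS_bot]
  rfl

theorem diaDown_top {X Y : C} (f : X ⟶ Y) : diaDown f ⊤ = imS f := by
  refine eq_of_forall_ge_iff fun t => ?_
  rw [gc_diaDown_boxUp _ _ _]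
  change PLe (truth X) (orth (ceil (f ≫ orth t.1))) ↔ PLe (im f) t.1
  rw [im_ple_iff, comp_eq_truth_iff, ← orth_zero, orth_ple_orth_iff]
  exact ⟨fun h => eq_zero_of_ple_zero ((ceil_ple_iff (s := (⊥ : SPred X))).1 h),
    fun h => (ceil_ple_iff (s := (⊥ : SPred X))).2 (h ▸ PLe.refl _)⟩

theorem kerS_comp {X Y Z : C} (f : X ⟶ Y) (g : Y ⟶ Z) : kerS (f ≫ g) = boxUp f (kerS g) := by
  rw [← boxUp_bot, boxUp_comp, boxUp_bot]

theorem imS_comp {X Y Z : C} (f : X ⟶ Y) (g : Y ⟶ Z) : imS (f ≫ g) = diaDown g (imS f) := by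
  rw [← diaDown_top, diaDown_comp, diaDown_top]

theorem imS_epi_comp {X Y Z : C} (e : X ⟶ Y) [Epi e] (f : Y ⟶ Z) : imS (e ≫ f) = imS f :=
  Subtype.ext (im_epi_comp e f)

theorem imS_of_epi {X Y : C} (e : X ⟶ Y) [Epi e] : imS e = ⊤ := Subtype.ext (im_of_epi e)

theorem kerS_of_comp_truth {X Y : C} {f : X ⟶ Y} (h : f ≫ truth Y = truth X) : kerS f = ⊥ := by
  rw [kerS, h, ← orthS_top]
  exact congrArg orthS (ceil_eq ⊤)

/-- A quotient of `s` has kernel `s`. -/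
theorem IsQuotientFor.kerS_eq {X Q : C} {ξ : X ⟶ Q} {s : SPred X} (h : IsQuotientFor ξ s.1) :
    kerS ξ = s := by
  rw [kerS, h.comp_truth]
  exact (congrArg orthS (ceil_eq (orthS s))).trans (orthS_orthS s)

theorem IsComprehensionFor.kerS_comp {K X Y : C} {π : K ⟶ X} {p : Pred X}
    (h : IsComprehensionFor π p) (f : Y ⟶ K) : kerS (f ≫ π) = kerS f := by
  rw [EffectusTheory.kerS_comp, kerS_of_comp_truth h.comp_truth, boxUp_bot]

theorem kerS_cokernel_π {X Y : C} (f : X ⟶ Y) : kerS (cokernel.π f) = imS f :=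
  IsQuotientFor.kerS_eq (s := imS f) (isQuotientFor_cokernel_π f)

theorem imS_kernel_ι {X Y : C} (f : X ⟶ Y) : imS (kernel.ι f) = kerS f := by
  have h := isComprehensionFor_kernel_ι f
  refine eq_of_forall_le_iff fun s => ?_
  change _ ↔ PLe s.1 (orth (ceil (f ≫ truth Y)))
  rw [sharp_ple_orth_iff, comp_ceil_eq_zero_iff, ← comp_eq_truth_iff.trans
    (iff_of_eq (congrArg (fun p => compr s.1 ≫ p = 0) (orth_orth (f ≫ truth Y)))),
    ← sharp_ple_iff]
  refine ⟨fun hs => PLe.trans hs (im_ple_iff.2 h.1), fun hs => ?_⟩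
  obtain ⟨g, hg, -⟩ := h.2 (compr s.1) (sharp_ple_iff.1 hs)
  change PLe s.1 (im _)
  rw [← im_compr s, ← hg]
  exact im_comp_ple _ _

/-! ### Normal subobjects and sharp predicates -/

theorem nsb_le_nsb {X : C} {s t : SPred X} : s.nsb ≤ t.nsb ↔ s ≤ t := by
  change Subobject.mk (compr s.1) ≤ Subobject.mk (compr t.1) ↔ PLe s.1 t.1
  rw [sharp_ple_iff]
  refine ⟨fun h => ?_, fun h => ?_⟩
  · rw [← Subobject.ofMkLEMk_comp h, Category.assoc, (isComprehensionFor_compr t.1).1,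
      Category.assoc]
  · obtain ⟨g, hg, -⟩ := (isComprehensionFor_compr t.1).2 (compr s.1) h
    exact Subobject.mk_le_mk_of_comm g hg

theorem ker_eq_nsb {X Y : C} (f : X ⟶ Y) : Nsb.ker f = (kerS f).nsb := by
  refine Subtype.ext ?_
  change Subobject.mk (kernel.ι f) = Subobject.mk (compr (kerS f).1)
  have h := (isComprehensionFor_kernel_ι f).of_im
  rw [show im (kernel.ι f) = (kerS f).1 from congrArg Subtype.val (imS_kernel_ι f)] at h
  obtain ⟨e, he⟩ := h.exists_iso (isComprehensionFor_compr (kerS f).1)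
  exact Subobject.mk_eq_mk_of_comm _ _ e he

/-- Sharp predicates and normal subobjects form isomorphic posets. -/
noncomputable def nsbIso (X : C) : SPred X ≃o Nsb X :=
  OrderIso.ofRelIsoLT <| RelIso.ofSurjective
    (OrderEmbedding.ltEmbedding ⟨⟨SPred.nsb, fun s t h =>
      le_antisymm (nsb_le_nsb.1 h.le) (nsb_le_nsb.1 h.ge)⟩, nsb_le_nsb⟩)
    fun ⟨S, Y, f, h⟩ => ⟨kerS f, by subst h; exact (ker_eq_nsb f).symm⟩

theorem nsb_injective (X : C) : Function.Injective (SPred.nsb : SPred X → Nsb X) :=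
  (nsbIso X).injective

theorem isLUB_nsb_pair {X : C} {s t x : SPred X} :
    IsLUB {s.nsb, t.nsb} x.nsb ↔ IsLUB {s, t} x := by
  have h := (nsbIso X).isLUB_image' (s := {s, t}) (x := x)
  rwa [Set.image_pair] at h

theorem isGLB_nsb_pair {X : C} {s t x : SPred X} :
    IsGLB {s.nsb, t.nsb} x.nsb ↔ IsGLB {s, t} x := by
  have h := (nsbIso X).isGLB_image' (s := {s, t}) (x := x)
  rwa [Set.image_pair] at h

theorem imS_nsb_arrow_comp {X Y : C} (s : SPred X) (f : X ⟶ Y) :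
    imS (s.nsb.1.arrow ≫ f) = diaDown f s := by
  change imS ((Subobject.mk (compr s.1)).arrow ≫ f) = imS (compr s.1 ≫ f)
  rw [← Subobject.underlyingIso_hom_comp_eq_mk, Category.assoc, imS_epi_comp]

/-- The kernel of a cokernel is the image, so the dictionary reduces to `kerS_cokernel_π`. -/
theorem directImage_nsb {X Y : C} (f : X ⟶ Y) (s : SPred X) :
    directImage f s.nsb = (diaDown f s).nsb := by
  rw [directImage, ker_eq_nsb, kerS_cokernel_π, imS_nsb_arrow_comp]

theorem inverseImage_nsb {X Y : C} (f : X ⟶ Y) (s : SPred Y) :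
    inverseImage f s.nsb = (boxUp f s).nsb := by
  rw [inverseImage, ker_eq_nsb, kerS_comp, kerS_cokernel_π,
    ← Category.comp_id s.nsb.1.arrow, imS_nsb_arrow_comp, diaDown_id]

theorem nsb_zero_eq (X : C) : Nsb.zero X = (⊥ : SPred X).nsb := by
  rw [Nsb.zero, ker_eq_nsb, kerS_of_comp_truth (Category.id_comp _)]

theorem nsb_one_eq (X : C) : Nsb.one X = (⊤ : SPred X).nsb := by
  have := (isComprehensionFor_compr (⊤ : SPred X).1).isIso (im_compr ⊤)
  exact Subtype.ext (Subobject.mk_eq_top_of_isIso (compr (⊤ : SPred X).1)).symm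

theorem exactAt_iff {X Y Z : C} {f : X ⟶ Y} {g : Y ⟶ Z} : ExactAt f g ↔ imS f = kerS g := by
  have h : ExactAt f g ↔ Nsb.ker (cokernel.π f) = Nsb.ker g :=
    ⟨fun h => Subtype.ext h, fun h => congrArg Subtype.val h⟩
  rw [h, ker_eq_nsb, ker_eq_nsb, (nsb_injective Y).eq_iff, kerS_cokernel_π]

theorem leftModularAt_nsb {X Y : C} {f : X ⟶ Y} {s : SPred X} :
    LeftModularAt f s.nsb ↔ IsLUB {s, kerS f} (boxUp f (diaDown f s)) := by
  rw [LeftModularAt, nsb_zero_eq, inverseImage_nsb, directImage_nsb, inverseImage_nsb,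
    isLUB_nsb_pair, boxUp_bot]

theorem rightModularAt_nsb {X Y : C} {f : X ⟶ Y} {s : SPred Y} :
    RightModularAt f s.nsb ↔ IsGLB {s, imS f} (diaDown f (boxUp f s)) := by
  rw [RightModularAt, nsb_one_eq, directImage_nsb, inverseImage_nsb, directImage_nsb,
    isGLB_nsb_pair, diaDown_top]

theorem kerS_zero (X Y : C) : kerS (0 : X ⟶ Y) = ⊤ := by
  rw [kerS, zero_comp, ← orthS_bot]
  exact congrArg orthS (ceil_eq ⊥)

theorem imS_zero (X Y : C) : imS (0 : X ⟶ Y) = ⊥ :=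
  Subtype.ext (IsImage.im_eq ⟨by simp, fun q _ => zero_ple q⟩)

/-- The modularity conditions correspond termwise under `nsbIso`. Exactness at the outer ends has no
counterpart on the right because it is automatic: quotients are epi, and comprehensions are total
and so have zero kernel. -/
theorem snakeHypotheses_iff {A B D A' B' D' : C} (f : A ⟶ B) (g : B ⟶ D) (h : A' ⟶ B')
    (k : B' ⟶ D') (b : B ⟶ B') : SnakeHypotheses f g h k b ↔ SnakeConditions f g h k b := by
  have key : ∀ {X Y Z : C} (f : X ⟶ Y) (g : Y ⟶ Z),
      ExactAt f g ↔ orth (im f) = ceil (g ≫ truth Z) := fun f g => by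
    rw [exactAt_iff, kerS]
    refine ⟨fun h => ?_, fun h => ?_⟩
    · rw [show im f = orth (ceil (g ≫ truth _)) from congrArg Subtype.val h, orth_orth]
    · exact Subtype.ext ((orth_orth _).symm.trans (congrArg orth h))
  constructor
  · intro H
    have hk := exactAt_iff.1 H.exact_B'
    refine ⟨?_, ?_, ?_, ?_, (key _ _).1 H.exact_B, (key _ _).1 H.exact_B',
      isACokernel_iff_isSharpQuotient.1 H.isACokernel_g,
      isAKernel_iff_isComprehension.1 H.isAKernel_h⟩
    · rw [Set.pair_comm]; exact leftModularAt_nsb.1 H.leftModular_b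
    · exact rightModularAt_nsb.1 H.rightModular_b
    · rw [Set.pair_comm, hk]; exact leftModularAt_nsb.1 H.leftModular_k
    · rw [show boxUp b 0 = kerS b from boxUp_bot b]
      exact rightModularAt_nsb.1 H.rightModular_f
  · intro H
    have hk := (key _ _).2 H.orth_im_h
    have hg := H.isSharpQuotient_g
    have hh := H.isComprehension_h
    refine ⟨(key _ _).2 H.orth_im_f, ?_, ?_, hk, isACokernel_iff_isSharpQuotient.2 hg,
      isAKernel_iff_isComprehension.2 hh, ?_, ?_, ?_, ?_⟩
    · obtain ⟨p, -, hp⟩ := hg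
      have := hp.epi
      rw [exactAt_iff, imS_of_epi, kerS_zero]
    · obtain ⟨p, hp⟩ := hh
      rw [exactAt_iff, imS_zero, kerS_of_comp_truth hp.comp_truth]
    · rw [leftModularAt_nsb, Set.pair_comm]; exact H.box_dia_b
    · exact rightModularAt_nsb.2 H.dia_box_b
    · have h1 := H.dia_box_f
      rw [show boxUp b 0 = kerS b from boxUp_bot b] at h1
      exact rightModularAt_nsb.2 h1
    · rw [leftModularAt_nsb, Set.pair_comm, ← exactAt_iff.1 hk]; exact H.box_dia_k

end Sharp

theorem IsComprehension.isPure {K X : C} {π : K ⟶ X} (h : IsComprehension π) : IsPure π :=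
  ⟨K, 𝟙 K, π, ⟨0, isQuotientFor_of_isIso _⟩, h, (Category.id_comp _).symm⟩

theorem IsQuotient.isPure {X Q : C} {ξ : X ⟶ Q} (h : IsQuotient ξ) : IsPure ξ :=
  ⟨Q, ξ, 𝟙 Q, h, ⟨_, isComprehensionFor_of_isIso _⟩, (Category.comp_id _).symm⟩

/-! ### Comprehensions split -/

section AndThen

variable [AndThenEffectus C]

theorem diamondPositive_asrt {X : C} (p : Pred X) : DiamondPositive (asrt p) :=
  (AndThenEffectus.existsUnique_asrt p).choose_spec.1.1

theorem asrt_comp_truth {X : C} (p : Pred X) : asrt p ≫ truth X = p :=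
  (AndThenEffectus.existsUnique_asrt p).choose_spec.1.2

theorem DiamondPositive.eq_asrt {X : C} {f : X ⟶ X} {p : Pred X} (h : DiamondPositive f)
    (hp : f ≫ truth X = p) : f = asrt p :=
  (AndThenEffectus.existsUnique_asrt p).unique ⟨h, hp⟩
    ⟨diamondPositive_asrt p, asrt_comp_truth p⟩

theorem DiamondPositive.diamondAdjoint {X : C} {f : X ⟶ X} (h : DiamondPositive f) :
    DiamondAdjoint f f := by
  obtain ⟨-, g, hg, rfl⟩ := h
  funext s
  rw [diaUp_comp, diaDown_comp, show diaUp g = diaDown g from hg]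

theorem imS_asrt {X : C} (s : SPred X) : imS (asrt s.1) = s := by
  rw [← diaDown_top, ← show diaUp _ = diaDown _ from (diamondPositive_asrt s.1).diamondAdjoint,
    diaUp]
  change ceilS (asrt s.1 ≫ truth X) = s
  rw [asrt_comp_truth, ceil_eq]

/-- In a pure factorization of `asrt s.1` the comprehension part has image `s`, so up to an
isomorphism it is `π`. Totality of `π` then determines the truth value of the quotient part. -/
theorem asrt_factor {K X : C} {π : K ⟶ X} {s : SPred X} (h : IsComprehensionFor π s.1) :
    ∃ ξ : X ⟶ K, IsQuotientFor ξ (orth s.1) ∧ asrt s.1 = ξ ≫ π := by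
  obtain ⟨Z, ξ, ρ, ⟨q, hq⟩, ⟨p, hp⟩, e⟩ := isPure_asrt s.1
  have := hq.epi
  have hs : im ρ = s.1 := by
    rw [← im_epi_comp ξ ρ, ← e]
    exact congrArg Subtype.val (imS_asrt s)
  have hρ := hp.of_im
  rw [hs] at hρ
  obtain ⟨i, rfl⟩ := hρ.exists_iso h
  have hq' := hq.comp_isIso i.hom
  have hqs : q = orth s.1 := by
    rw [← orth_orth q, ← hq'.comp_truth, ← h.comp_truth, ← Category.assoc, Category.assoc ξ, ← e,
      asrt_comp_truth]
  exact ⟨ξ ≫ i.hom, hqs ▸ hq', by rw [e, Category.assoc]⟩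

/-- The composite is pure, total and of full image, so both its quotient part and its comprehension
part are isomorphisms. -/
theorem isIso_comp_of_asrt {K X : C} {π : K ⟶ X} {ξ : X ⟶ K} {s : SPred X}
    (h : IsComprehensionFor π s.1) (hξ : IsQuotientFor ξ (orth s.1)) : IsIso (π ≫ ξ) := by
  have := hξ.epi
  have htot : (π ≫ ξ) ≫ truth K = truth K := by
    rw [Category.assoc, hξ.comp_truth, orth_orth, h.1, h.comp_truth]
  have him : im (π ≫ ξ) = truth K := by
    rw [← orth_orth (im _), ← orth_zero]
    congr 1
    rw [← cancel_epi ξ, comp_zero]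
    have h0 : (π ≫ ξ) ≫ orth (im (π ≫ ξ)) = 0 :=
      comp_eq_zero_iff_ple_orth_im.2 (PLe.refl _)
    rw [Category.assoc, comp_eq_zero_iff_ple_orth_im, h.im_eq s.2] at h0
    -- The complement of the image, pulled back along `ξ`, is below `s` because `ξ` has truth value
    -- `s`, and below `orth s` because `π` annihilates it.
    refine eq_zero_of_ple_zero (ceil_ple_iff (s := (⊥ : SPred X)) |>.1 ?_)
    change ceilS _ ≤ _
    rw [← inf_orthS_self s]
    refine le_inf (ceil_ple_iff.2 ?_) (ceil_ple_iff.2 h0)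
    rw [← orth_orth s.1, ← hξ.comp_truth]
    exact comp_ple_comp _ (ple_truth _)
  obtain ⟨Z, ζ, ρ, ⟨q, hq⟩, ⟨p, hp⟩, e⟩ := AndThenEffectus.isPure_comp π ξ ⟨_, h⟩ ⟨_, hξ⟩
  have := hq.epi
  rw [e] at htot him ⊢
  have := hq.isIso (comp_truth_of_comp htot)
  have := hp.isIso (by rwa [im_epi_comp] at him)
  infer_instance

theorem IsComprehensionFor.exists_retraction {K X : C} {π : K ⟶ X} {p : Pred X}
    (h : IsComprehensionFor π p) : ∃ ρ : X ⟶ K, π ≫ ρ = 𝟙 K := by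
  have h' : IsComprehensionFor π (imS π).1 := h.of_im
  obtain ⟨ξ, hξ, -⟩ := asrt_factor h'
  have := isIso_comp_of_asrt h' hξ
  exact ⟨ξ ≫ inv (π ≫ ξ), by rw [← Category.assoc, IsIso.hom_inv_id]⟩

/-- A retraction `σ` of `π` transports `q` to the predicate `orth (σ ≫ orth q)` on `X`, which bounds
the image of `ρ ≫ π`. Maps landing in that image therefore factor through `π` and then through `ρ`.
-/
theorem IsComprehension.comp {L K X : C} {ρ : L ⟶ K} {π : K ⟶ X} (hρ : IsComprehension ρ)
    (hπ : IsComprehension π) : IsComprehension (ρ ≫ π) := by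
  obtain ⟨q, hq⟩ := hρ
  obtain ⟨p, hp⟩ := hπ
  have := hq.mono
  have := hp.mono
  obtain ⟨σ, hσ⟩ := hp.exists_retraction
  refine ⟨im (ρ ≫ π), (isImage_im _).1, fun g hg => ?_⟩
  obtain ⟨g', rfl, -⟩ := hp.of_im.2 g (comp_eq_truth_of_ple (im_comp_ple ρ π) hg)
  have h1 : PLe (im (ρ ≫ π)) (orth (σ ≫ orth q)) := by
    rw [im_ple_iff, comp_eq_truth_iff, orth_orth, Category.assoc, reassoc_of% hσ,
      comp_orth_eq_zero hq.1]
  have h2 := comp_eq_truth_of_ple h1 hg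
  rw [comp_eq_truth_iff, orth_orth, Category.assoc, reassoc_of% hσ, ← comp_eq_truth_iff] at h2
  obtain ⟨g'', rfl, -⟩ := hq.2 g' h2
  exact ⟨g'', (Category.assoc _ _ _).symm, fun y hy => (cancel_mono (ρ ≫ π)).1
    (by rw [hy, Category.assoc])⟩

theorem IsPure.comp {X Y Z : C} {f : X ⟶ Y} {g : Y ⟶ Z} (hf : IsPure f) (hg : IsPure g) :
    IsPure (f ≫ g) := by
  obtain ⟨U, ξ, π, ⟨p, hξ⟩, hπ, rfl⟩ := hf
  obtain ⟨V, ζ, ρ, hζ, hρ, rfl⟩ := hg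
  obtain ⟨W, η, σ, ⟨q, hη⟩, hσ, e⟩ := AndThenEffectus.isPure_comp π ζ hπ hζ
  exact ⟨W, ξ ≫ η, σ ≫ ρ, ⟨_, hξ.comp hη⟩, hσ.comp hρ, by
    simp only [Category.assoc, reassoc_of% e]⟩

/-- The square is again `⋄`-positive, and its truth value is `s` because the image of `asrt s.1` is
`s`; uniqueness of `asrt` concludes. -/
theorem asrt_comp_asrt {X : C} (s : SPred X) : asrt s.1 ≫ asrt s.1 = asrt s.1 := by
  have h := diamondPositive_asrt s.1
  refine DiamondPositive.eq_asrt ⟨h.1.comp h.1, _, h.diamondAdjoint, rfl⟩ ?_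
  have h1 := (isImage_im (asrt s.1)).1
  rw [show im (asrt s.1) = s.1 from congrArg Subtype.val (imS_asrt s), asrt_comp_truth] at h1
  rw [Category.assoc, asrt_comp_truth, h1]

theorem comp_eq_id_of_asrt {K X : C} {π : K ⟶ X} {ξ : X ⟶ K} [Mono π] [Epi ξ] {s : SPred X}
    (h : asrt s.1 = ξ ≫ π) : π ≫ ξ = 𝟙 K := by
  have h1 := asrt_comp_asrt s
  rw [h, Category.assoc, cancel_epi, ← Category.assoc] at h1
  rw [← cancel_mono π, h1, Category.id_comp]

end AndThen

/-! ### The dagger of comprehensions and sharp quotients -/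

section Dagger

variable [DaggerEffectus C]

open DaggerEffectus

/-- The `†`-positive square root is its own dagger, hence `⋄`-self-adjoint. So `f` is `⋄`-positive,
and uniqueness of `asrt` at the predicate `1` identifies it with the identity. -/
theorem eq_id_of_daggerPositive {X : C} {f : X ⟶ X} (hf : DaggerPositive dag f)
    (ht : f ≫ truth X = truth X) : f = 𝟙 X := by
  obtain ⟨r, ⟨⟨Y, g, hr⟩, rfl⟩, -⟩ := existsUnique_sqrt f hf
  have hp : IsPure r := hr ▸ g.2.comp (dag g).2
  have hdag : (dag ⟨r, hp⟩).1 = r := by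
    subst hr
    rw [dag_comp, dag_dag]
  have hadj : DiamondAdjoint r r := by
    have := diamondAdjoint_dag ⟨r, hp⟩
    rwa [hdag] at this
  have h1 : DiamondPositive (r ≫ r) := ⟨hp.comp hp, r, hadj, rfl⟩
  have h2 : DiamondPositive (𝟙 X) :=
    ⟨IsQuotient.isPure ⟨0, isQuotientFor_of_isIso _⟩, 𝟙 X,
      funext fun s => (diaUp_id s).trans (diaDown_id s).symm, (Category.id_comp _).symm⟩
  rw [h1.eq_asrt ht, h2.eq_asrt (Category.id_comp _)]

/-- The dagger of a pure map. -/
noncomputable def adj {X Y : C} (f : X ⟶ Y) (hf : IsPure f) : Y ⟶ X := (dag ⟨f, hf⟩).1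

theorem isPure_adj {X Y : C} {f : X ⟶ Y} (hf : IsPure f) : IsPure (adj f hf) := (dag ⟨f, hf⟩).2

theorem adj_adj {X Y : C} {f : X ⟶ Y} (hf : IsPure f) : adj (adj f hf) (isPure_adj hf) = f :=
  congrArg Subtype.val (dag_dag ⟨f, hf⟩)

theorem adj_comp {X Y Z : C} {f : X ⟶ Y} {g : Y ⟶ Z} (hf : IsPure f) (hg : IsPure g) :
    adj g hg ≫ adj f hf = adj (f ≫ g) (hf.comp hg) :=
  (dag_comp ⟨f, hf⟩ ⟨g, hg⟩ _).symm

theorem adj_eq_of_asrt {K X : C} {π : K ⟶ X} {ξ : X ⟶ K} {s : SPred X} (hπ : IsPure π)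
    (hξ : IsPure ξ) (hid : π ≫ ξ = 𝟙 K) (h : asrt s.1 = ξ ≫ π) : adj π hπ = ξ := by
  have congr_adj : ∀ {X Y : C} {f g : X ⟶ Y} (hf : IsPure f) (hg : IsPure g), f = g →
      adj f hf = adj g hg := by
    rintro _ _ f _ _ _ rfl
    rfl
  have h1 : adj π hπ ≫ adj ξ hξ = ξ ≫ π := by
    rw [adj_comp, congr_adj _ (isPure_asrt s.1) h.symm, ← h]
    exact dag_asrt s.1
  have hK : IsPure (𝟙 K) := IsQuotient.isPure ⟨0, isQuotientFor_of_isIso _⟩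
  have h2 : adj ξ hξ ≫ adj π hπ = 𝟙 K := by
    rw [adj_comp, congr_adj _ hK hid]
    exact dag_id hK
  -- This map is `†`-positive, and it is total because composing it with `adj ξ hξ ≫ ξ` gives the
  -- identity.
  have h3 : π ≫ adj π hπ = 𝟙 K := by
    refine eq_id_of_daggerPositive ⟨X, ⟨π, hπ⟩, rfl⟩ (comp_truth_of_comp (g := adj ξ hξ ≫ ξ) ?_)
    rw [Category.assoc π, reassoc_of% h1, hid, Category.comp_id, hid, Category.id_comp]
  calc adj π hπ = (adj π hπ ≫ adj ξ hξ) ≫ adj π hπ := by rw [Category.assoc, h2, Category.comp_id]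
    _ = ξ := by rw [h1, Category.assoc, h3, Category.comp_id]

/-- The dagger of a comprehension is a retraction of it. -/
theorem IsComprehension.comp_adj {K X : C} {π : K ⟶ X} (h : IsComprehension π) :
    π ≫ adj π h.isPure = 𝟙 K := by
  have hp := h.isPure
  obtain ⟨p, h⟩ := h
  have := h.mono
  obtain ⟨ξ, hξ, e⟩ := asrt_factor (s := imS π) h.of_im
  have := hξ.epi
  have hid := comp_eq_id_of_asrt e
  rw [adj_eq_of_asrt hp (IsQuotient.isPure ⟨_, hξ⟩) hid e, hid]

/-- The dagger of a sharp quotient is a comprehension and a section of the quotient. -/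
theorem IsQuotientFor.adj_spec {X Q : C} {ξ : X ⟶ Q} {s : SPred X}
    (h : IsQuotientFor ξ s.1) (hp : IsPure ξ) :
    IsComprehensionFor (adj ξ hp) (orthS s).1 ∧ adj ξ hp ≫ ξ = 𝟙 Q := by
  have hπ := isComprehensionFor_compr (orthS s).1
  obtain ⟨ζ, hζ, e⟩ := asrt_factor (s := orthS s) hπ
  rw [show orth (orthS s).1 = s.1 from orth_orth _] at hζ
  -- Quotients of `s` are unique up to isomorphism, and the isomorphism is absorbed into the
  -- comprehension.
  obtain ⟨i, rfl⟩ := h.exists_iso hζ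
  have hπ' := hπ.isIso_comp i.hom
  have := h.epi
  have := hπ'.mono
  rw [Category.assoc] at e
  have hid := comp_eq_id_of_asrt e
  have hpure : IsPure (i.hom ≫ compr (orthS s).1) := IsComprehension.isPure ⟨_, hπ'⟩
  obtain rfl := adj_eq_of_asrt hpure hp hid e
  rw [adj_adj]
  exact ⟨hπ', hid⟩

theorem diaDown_adj {X Y : C} {f : X ⟶ Y} (hf : IsPure f) (s : SPred Y) :
    diaDown (adj f hf) s = orthS (boxUp f (orthS s)) := by
  rw [← diaUp_eq, show diaUp f = diaDown (adj f hf) from diamondAdjoint_dag ⟨f, hf⟩]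

theorem boxUp_adj {X Y : C} {f : X ⟶ Y} (hf : IsPure f) (s : SPred X) :
    boxUp (adj f hf) s = orthS (diaDown f (orthS s)) := by
  have h := diaDown_adj (isPure_adj hf) (orthS s)
  rw [adj_adj, orthS_orthS] at h
  rw [h, orthS_orthS]

/-! ### Direct and inverse images along comprehensions and sharp quotients -/

theorem diaDown_le_imS {X Y : C} (f : X ⟶ Y) (x : SPred X) : diaDown f x ≤ imS f := by
  rw [← diaDown_top]
  exact (gc_diaDown_boxUp f).monotone_l le_top

section Comprehensions

variable {K X : C} {π : K ⟶ X}

theorem IsComprehension.diaDown_injective (h : IsComprehension π) :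
    Function.Injective (diaDown π) := by
  refine Function.LeftInverse.injective (g := diaDown (adj π h.isPure)) fun s => ?_
  rw [← diaDown_comp, h.comp_adj, diaDown_id]

theorem IsComprehension.boxUp_diaDown (h : IsComprehension π) (x : SPred K) :
    boxUp π (diaDown π x) = x :=
  h.diaDown_injective ((gc_diaDown_boxUp π).l_u_l_eq_l x)

theorem IsComprehension.diaDown_boxUp (h : IsComprehension π) (x : SPred X) :
    diaDown π (boxUp π x) = x ⊓ imS π := by
  obtain ⟨p, h⟩ := h
  exact h.diaDown_boxUp x

/-- A left adjoint need not preserve meets. Here both arguments are inverse images, `boxUp π`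
preserves meets, and going back down only intersects with `imS π`. -/
theorem IsComprehension.diaDown_inf (h : IsComprehension π) (x y : SPred K) :
    diaDown π (x ⊓ y) = diaDown π x ⊓ diaDown π y := by
  conv_lhs => rw [← h.boxUp_diaDown x, ← h.boxUp_diaDown y, ← (gc_diaDown_boxUp π).u_inf,
    h.diaDown_boxUp]
  exact inf_eq_left.2 (inf_le_left.trans (diaDown_le_imS π x))

theorem IsComprehension.kerS_comp (h : IsComprehension π) {Y : C} (f : Y ⟶ K) :
    kerS (f ≫ π) = kerS f := by
  obtain ⟨p, h⟩ := h
  exact h.kerS_comp f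

/-- Complements become relative complements below `imS π`, since `⋄`-adjointness and the retraction
make `boxUp π` recover `orthS x`. -/
theorem IsComprehension.diaDown_orthS (h : IsComprehension π) (x : SPred K) :
    diaDown π (orthS x) = orthS (diaDown π x) ⊓ imS π := by
  have hu : boxUp π (orthS (diaDown π x)) = orthS x := by
    have h1 := diaDown_adj h.isPure (diaDown π x)
    rw [← diaDown_comp, h.comp_adj, diaDown_id] at h1
    exact (orthS_orthS _).symm.trans (congrArg orthS h1.symm)
  rw [← h.diaDown_boxUp, hu]

/-- A comprehension after its dagger acts on sharp predicates as a Sasaki projection. -/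
theorem IsComprehension.diaDown_diaDown_adj (h : IsComprehension π) (x : SPred X) :
    diaDown π (diaDown (adj π h.isPure) x) = (x ⊔ orthS (imS π)) ⊓ imS π := by
  rw [diaDown_adj, h.diaDown_orthS, h.diaDown_boxUp, orthS_inf, orthS_orthS]

theorem IsComprehension.boxUp_adj (h : IsComprehension π) (x : SPred K) :
    boxUp (adj π h.isPure) x = diaDown π x ⊔ orthS (imS π) := by
  rw [EffectusTheory.boxUp_adj, h.diaDown_orthS, orthS_inf, orthS_orthS]

end Comprehensions

section Quotients

variable {X Q : C} {ξ : X ⟶ Q} {s : SPred X}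

/-- Dual to intersecting with the image of a comprehension: the dagger of `ξ` is a comprehension of
`orthS s`, and `⋄`-adjointness exchanges the two formulas. -/
theorem IsQuotientFor.boxUp_diaDown (h : IsQuotientFor ξ s.1) (x : SPred X) :
    boxUp ξ (diaDown ξ x) = x ⊔ s := by
  have hp : IsPure ξ := IsQuotient.isPure ⟨_, h⟩
  obtain ⟨hπ, -⟩ := h.adj_spec hp
  have him : imS (adj ξ hp) = orthS s := Subtype.ext (hπ.im_eq (orthS s).2)
  have h1 := diaDown_adj (isPure_adj hp) x
  have h2 := boxUp_adj (isPure_adj hp) (diaDown ξ x)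
  rw [adj_adj] at h1 h2
  rw [h2, h1, orthS_orthS, hπ.diaDown_boxUp, orthS_inf, orthS_orthS, him, orthS_orthS]

theorem IsQuotientFor.diaDown_boxUp (h : IsQuotientFor ξ s.1) (x : SPred Q) :
    diaDown ξ (boxUp ξ x) = x := by
  refine le_antisymm ((gc_diaDown_boxUp ξ).l_u_le x) ?_
  have hp : IsPure ξ := IsQuotient.isPure ⟨_, h⟩
  have h1 : diaDown ξ (diaDown (adj ξ hp) x) = x := by
    rw [← diaDown_comp, (h.adj_spec hp).2, diaDown_id]
  exact h1.ge.trans ((gc_diaDown_boxUp ξ).monotone_l ((gc_diaDown_boxUp ξ _ _).1 h1.le))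

theorem IsQuotientFor.boxUp_injective (h : IsQuotientFor ξ s.1) :
    Function.Injective (boxUp ξ) :=
  Function.LeftInverse.injective (g := diaDown ξ) h.diaDown_boxUp

end Quotients

/-! ### The snake lemma -/

section Snake

theorem isComprehension_kernel_ι {X Y : C} (f : X ⟶ Y) : IsComprehension (kernel.ι f) :=
  ⟨_, isComprehensionFor_kernel_ι f⟩

theorem isQuotientFor_imS_cokernel_π {X Y : C} (f : X ⟶ Y) :
    IsQuotientFor (cokernel.π f) (imS f).1 :=
  isQuotientFor_cokernel_π f

variable {A B D A' B' D' : C} {f : A ⟶ B} {g : B ⟶ D} {h : A' ⟶ B'} {k : B' ⟶ D'}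
  {a : A ⟶ A'} {b : B ⟶ B'} {c : D ⟶ D'}

theorem kernel_map_comp_ι (hab : a ≫ h = f ≫ b) :
    kernel.map a b f h hab ≫ kernel.ι b = kernel.ι a ≫ f :=
  kernel.lift_ι _ _ _

theorem cokernel_π_comp_map (hab : a ≫ h = f ≫ b) :
    cokernel.π a ≫ cokernel.map a b f h hab = h ≫ cokernel.π b :=
  cokernel.π_desc _ _ _

theorem kernel_map_eq (hab : a ≫ h = f ≫ b) :
    kernel.map a b f h hab =
      kernel.ι a ≫ f ≫ adj (kernel.ι b) (isComprehension_kernel_ι b).isPure := by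
  rw [← Category.assoc, ← kernel_map_comp_ι hab, Category.assoc,
    (isComprehension_kernel_ι b).comp_adj, Category.comp_id]

theorem cokernel_map_eq (hab : a ≫ h = f ≫ b) (ha : IsPure (cokernel.π a)) :
    cokernel.map a b f h hab = adj (cokernel.π a) ha ≫ h ≫ cokernel.π b := by
  rw [← cokernel_π_comp_map hab, ← Category.assoc,
    ((isQuotientFor_imS_cokernel_π a).adj_spec ha).2, Category.id_comp]

/-- Pushed forward to `B`, the kernel side is `kerS b ⊓ kerS g`. The image side is `diaDown f (kerS
a)`, and `kerS a = boxUp f (kerS b)` because `h` has zero kernel. -/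
theorem exactAt_kernel_map (hab : a ≫ h = f ≫ b) (hbc : b ≫ k = g ≫ c)
    (hh : IsComprehension h) (hfg : imS f = kerS g)
    (hf : diaDown f (boxUp f (kerS b)) = kerS b ⊓ imS f) :
    ExactAt (kernel.map a b f h hab) (kernel.map b c g k hbc) := by
  have hι := isComprehension_kernel_ι b
  rw [exactAt_iff]
  apply hι.diaDown_injective
  rw [← imS_comp, kernel_map_comp_ι, imS_comp, imS_kernel_ι, ← hh.kerS_comp, hab, kerS_comp, hf,
    ← (isComprehension_kernel_ι c).kerS_comp, kernel_map_comp_ι, kerS_comp, hι.diaDown_boxUp,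
    imS_kernel_ι, hfg, inf_comm]

/-- Pulled back to `B'`, the image side is `imS h ⊔ imS b`. The kernel side is `boxUp k (imS c)`,
and `imS c = diaDown k (imS b)` because `g` is epi. -/
theorem exactAt_cokernel_map (hab : a ≫ h = f ≫ b) (hbc : b ≫ k = g ≫ c) [Epi g]
    (hk : boxUp k (diaDown k (imS b)) = imS h ⊔ imS b) :
    ExactAt (cokernel.map a b f h hab) (cokernel.map b c g k hbc) := by
  have hπ := isQuotientFor_imS_cokernel_π b
  have := (isQuotientFor_imS_cokernel_π a).epi
  rw [exactAt_iff]
  apply hπ.boxUp_injective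
  rw [← imS_epi_comp (cokernel.π a), cokernel_π_comp_map, imS_comp, hπ.boxUp_diaDown, ← kerS_comp,
    cokernel_π_comp_map, kerS_comp, kerS_cokernel_π, ← imS_epi_comp g, ← hbc, imS_comp, hk]

variable (a b c) in
/-- The connecting map of the snake lemma. -/
noncomputable def snakeConnecting (hg : IsPure g) (hh : IsPure h) : kernel c ⟶ cokernel a :=
  kernel.ι c ≫ adj g hg ≫ b ≫ adj h hh ≫ cokernel.π a

theorem imS_adj {s : SPred B} (hg : IsQuotientFor g s.1) (hp : IsPure g) :
    imS (adj g hp) = orthS s :=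
  Subtype.ext ((hg.adj_spec hp).1.im_eq (orthS s).2)

/-- The dagger of a sharp quotient after the quotient acts as a Sasaki projection. -/
theorem IsQuotientFor.diaDown_adj_diaDown {s : SPred B} (hg : IsQuotientFor g s.1) (hp : IsPure g)
    (x : SPred B) : diaDown (adj g hp) (diaDown g x) = (x ⊔ s) ⊓ orthS s := by
  have hc : IsComprehension (adj g hp) := ⟨_, (hg.adj_spec hp).1⟩
  have h1 := hc.diaDown_diaDown_adj x
  rwa [adj_adj, imS_adj hg hp, orthS_orthS] at h1

/-- Commutativity gives `boxUp g (kerS c) = boxUp b (imS h)`. As this lies above `s`, the Sasaki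
projection just intersects it with `orthS s`. -/
theorem diaDown_adj_kerS {s : SPred B} (hg : IsQuotientFor g s.1) (hp : IsPure g)
    (hbc : b ≫ k = g ≫ c) (hhk : imS h = kerS k) (hs : s ≤ boxUp b (imS h)) :
    diaDown (adj g hp) (kerS c) = boxUp b (imS h) ⊓ orthS s := by
  rw [← hg.diaDown_boxUp (kerS c), ← kerS_comp, ← hbc, kerS_comp, ← hhk,
    hg.diaDown_adj_diaDown, sup_eq_left.2 hs]

theorem imS_le_boxUp (hab : a ≫ h = f ≫ b) : imS f ≤ boxUp b (imS h) := by
  rw [← gc_diaDown_boxUp _ _ _, ← imS_comp, ← hab, imS_comp]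
  exact diaDown_le_imS h _

/-- Pushed forward to `B`, the image side is `(kerS b ⊔ imS f) ⊓ orthS (imS f)`. On the kernel side
`boxUp b` is applied to `(diaDown b (imS f) ⊔ orthS (imS h)) ⊓ imS h`, which collapses to `diaDown b
(imS f)` by orthomodularity. Left-modularity of `b` matches the two. -/
theorem exactAt_snakeConnecting_left (hab : a ≫ h = f ≫ b) (hbc : b ≫ k = g ≫ c)
    (hg : IsQuotientFor g (imS f).1) (hp : IsPure g) (hh : IsComprehension h)
    (hhk : imS h = kerS k) (hb : boxUp b (diaDown b (imS f)) = kerS b ⊔ imS f) :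
    ExactAt (kernel.map b c g k hbc) (snakeConnecting a b c hp hh.isPure) := by
  have hι := isComprehension_kernel_ι c
  have hc : IsComprehension (adj g hp) := ⟨_, (hg.adj_spec hp).1⟩
  have hm : diaDown h (imS a) = diaDown b (imS f) := by rw [← imS_comp, ← imS_comp, hab]
  have hmt : diaDown b (imS f) ≤ imS h := hm ▸ diaDown_le_imS h _
  rw [exactAt_iff]
  apply hι.diaDown_injective
  apply hc.diaDown_injective
  rw [← imS_comp, kernel_map_comp_ι, imS_comp, imS_kernel_ι, hg.diaDown_adj_diaDown, ← hb,
    snakeConnecting, kerS_comp, hι.diaDown_boxUp, imS_kernel_ι, hc.diaDown_inf, kerS_comp,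
    hc.diaDown_boxUp, kerS_comp, kerS_comp, kerS_cokernel_π, hh.boxUp_adj, hm, imS_adj hg hp,
    diaDown_adj_kerS hg hp hbc hhk (imS_le_boxUp hab), ← inf_inf_distrib_right,
    ← (gc_diaDown_boxUp b).u_inf, inf_comm (_ ⊔ _) (imS h), sup_comm, inf_orthS_sup hmt]

/-- Transported to `B'`, the kernel side is `imS h ⊓ imS b`. On the image side `diaDown b` is
applied to `(boxUp b (imS h) ⊓ orthS (imS f)) ⊔ imS f`, the last term coming from `imS a`;
orthomodularity reduces this to `boxUp b (imS h)`. -/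
theorem exactAt_snakeConnecting_right (hab : a ≫ h = f ≫ b) (hbc : b ≫ k = g ≫ c)
    (hg : IsQuotientFor g (imS f).1) (hp : IsPure g) (hh : IsComprehension h)
    (hhk : imS h = kerS k) (hb : diaDown b (boxUp b (imS h)) = imS h ⊓ imS b) :
    ExactAt (snakeConnecting a b c hp hh.isPure) (cokernel.map a b f h hab) := by
  have hπ := isQuotientFor_imS_cokernel_π a
  have hle := imS_le_boxUp hab
  rw [exactAt_iff]
  apply hπ.boxUp_injective
  apply hh.diaDown_injective
  have hz : diaDown b (boxUp b (imS h) ⊓ orthS (imS f)) ≤ imS h :=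
    (gc_diaDown_boxUp b _ _).2 inf_le_left
  rw [← kerS_comp, cokernel_π_comp_map, kerS_comp, kerS_cokernel_π, hh.diaDown_boxUp,
    inf_comm (imS b), ← hb, snakeConnecting, imS_comp, imS_kernel_ι, diaDown_comp, diaDown_comp,
    diaDown_comp, hπ.boxUp_diaDown, (gc_diaDown_boxUp h).l_sup, hh.diaDown_diaDown_adj,
    diaDown_adj_kerS hg hp hbc hhk hle, sup_comm _ (orthS (imS h)), inf_comm _ (imS h),
    inf_orthS_sup hz, ← imS_comp a, hab, imS_comp, ← (gc_diaDown_boxUp b).l_sup, sup_comm,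
    inf_comm _ (orthS _), sup_orthS_inf hle]

end Snake

end Dagger

end EffectusTheory

theorem mainTheorem4 {𝒞 : Type u} [Category.{v} 𝒞] [HasZeroMorphisms 𝒞] [HasFiniteCoproducts 𝒞]
    [Effectus 𝒞] [DaggerEffectus 𝒞] {A B C A' B' C' : 𝒞}
    (f : A ⟶ B) (g : B ⟶ C) (h : A' ⟶ B') (k : B' ⟶ C')
    (a : A ⟶ A') (b : B ⟶ B') (c : C ⟶ C')
    (hab : a ≫ h = f ≫ b) (hbc : b ≫ k = g ≫ c) :
    (SnakeHypotheses f g h k b ↔ SnakeConditions f g h k b) ∧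
    (∃ (hb : IsPure (kernel.ι b)) (hc : IsPure (kernel.ι c))
        (ha' : IsPure (cokernel.π a)) (hb' : IsPure (cokernel.π b)),
      kernel.map a b f h hab = kernel.ι a ≫ f ≫ (DaggerEffectus.dag ⟨kernel.ι b, hb⟩).1 ∧
      kernel.map b c g k hbc = kernel.ι b ≫ g ≫ (DaggerEffectus.dag ⟨kernel.ι c, hc⟩).1 ∧
      cokernel.map a b f h hab =
        (DaggerEffectus.dag ⟨cokernel.π a, ha'⟩).1 ≫ h ≫ cokernel.π b ∧
      cokernel.map b c g k hbc =
        (DaggerEffectus.dag ⟨cokernel.π b, hb'⟩).1 ≫ k ≫ cokernel.π c) ∧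
    (SnakeHypotheses f g h k b →
      ∃ d : kernel c ⟶ cokernel a,
        ExactAt (kernel.map a b f h hab) (kernel.map b c g k hbc) ∧
        ExactAt (kernel.map b c g k hbc) d ∧
        ExactAt d (cokernel.map a b f h hab) ∧
        ExactAt (cokernel.map a b f h hab) (cokernel.map b c g k hbc)) := by
  have hpure {X Y : 𝒞} (m : X ⟶ Y) : IsPure (cokernel.π m) :=
    IsQuotient.isPure ⟨_, isQuotientFor_cokernel_π m⟩
  refine ⟨snakeHypotheses_iff f g h k b,
    ⟨(isComprehension_kernel_ι b).isPure, (isComprehension_kernel_ι c).isPure, hpure a, hpure b,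
      kernel_map_eq hab, kernel_map_eq hbc, cokernel_map_eq hab _, cokernel_map_eq hbc _⟩,
    fun H => ?_⟩
  have hfg := exactAt_iff.1 H.exact_B
  have hhk := exactAt_iff.1 H.exact_B'
  have hh := isAKernel_iff_isComprehension.1 H.isAKernel_h
  have S := (snakeHypotheses_iff f g h k b).1 H
  -- The predicate of a sharp quotient is its kernel, which exactness at `B` identifies with the
  -- image of `f`.
  have hg : IsQuotientFor g (imS f).1 := by
    obtain ⟨p, hs, hp⟩ := S.isSharpQuotient_g
    rwa [hfg, IsQuotientFor.kerS_eq (s := ⟨p, hs⟩) hp]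
  have := hg.epi
  have hp : IsPure g := IsQuotient.isPure ⟨_, hg⟩
  have hf := S.dia_box_f.unique isGLB_pair
  rw [show boxUp b 0 = kerS b from boxUp_bot b] at hf
  exact ⟨snakeConnecting a b c hp hh.isPure,
    exactAt_kernel_map hab hbc hh hfg hf,
    exactAt_snakeConnecting_left hab hbc hg hp hh hhk (S.box_dia_b.unique isLUB_pair),
    exactAt_snakeConnecting_right hab hbc hg hp hh hhk (S.dia_box_b.unique isGLB_pair),
    exactAt_cokernel_map hab hbc (S.box_dia_k.unique isLUB_pair)⟩
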